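/- Let $\mathcal X,\mathcal Y,\mathcal Z$ be finite alphabets, $P_X$ a distribution on $\mathcal X$, and $P_{Y|X}$, $P_{Z|X}$ two discrete memoryless channels from $\mathcal X$ to $\mathcal Y$ and $\mathcal Z$; put $P_{XYZ}=P_X\times P_{Y|X}\times P_{Z|X}$. All logarithms are natural. In the biometrical identification problem with block length $n$ and $M\ge 1$ items, the feature vectors $X^n(1),\dots,X^n(M)$ are drawn independently from $P_X^n$; for each $m$ the database stores $Y^n(m)$, the output of $P_{Y|X}^n$ on input $X^n(m)$; an index $W$ is uniform on $\{1,\dots,M\}$ and independent of these, and $Z^n$ is the output of $P_{Z|X}^n$ on input $X^n(W)$, conditionally independent of everything else given $X^n(W)$. An identification function is a deterministic map $g:(\mathcal Y^n)^M\times\mathcal Z^n\to\{1,\dots,M\}$, and $\mathrm P_{\mathrm c}(g)=1-\mathrm P_{\mathrm e}(g)=\Pr\{g(Y^n(1),\dots,Y^n(M),Z^n)=W\}$. For $R\in\mathbb R$ let $\mathrm P_{\mathrm c}^*(n,R)$ be the maximum of $\mathrm P_{\mathrm c}(g)$ over all integers $M\ge1$ with $\log M\ge nR$ and all identification functions $g$.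 A rate $R$ is called $\varepsilon$-achievable if there are $M_n\ge 1$ and identification functions $g_n$ for block length $n$ and $M_n$ items with $\liminf_{n\to\infty}\frac1n\log M_n\ge R$ and $\limsup_{n\to\infty}\mathrm P_{\mathrm e}(g_n)\le\varepsilon$; the capacity $C_{\mathrm{bio}}$ is the supremum of the rates that lie, for every $\varepsilon\in(0,1)$, in the closure of the set of $\varepsilon$-achievable rates. Let $$\mathrm V:=\mathrm{Var}\left[\log\frac{P_{Z|Y}(Z|Y)}{P_Z(Z)}\right],\qquad (Y,Z)\sim P_{YZ},$$ be the unconditional variance of the information density, and assume $\mathrm V>0$. Then for every sequence of positive numbers $(\xi_n)_{n\ge1}$ with $\xi_n\to0$ and $\sqrt n\,\xi_n\to\infty$, $$\lim_{n\to\infty}-\frac{\log \mathrm P_{\mathrm c}^*(n,C_{\mathrm{bio}}+\xi_n)}{n\xi_n^2}=\frac1{2\mathrm V} \qquad\text{and}\qquad \lim_{n\to\infty}-\frac{\log\bigl(1-\mathrm P_{\mathrm c}^*(n,C_{\mathrm{bio}}-\xi_n)\bigr)}{n\xi_n^2}=\frac1{2\mathrm V}.$$ -/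

import Mathlib

open Filter Topology

/-- The data of the biometrical identification problem on finite alphabets: a source
distribution `P_X` and two channels, `P_{Y|X}` (enrollment) and `P_{Z|X}` (identification). -/
structure BioModel (X Y Z : Type*) [Fintype X] [Fintype Y] [Fintype Z] where
  /-- `P_X(x)` -/
  pX : X → ℝ
  /-- `P_{Y|X}(y|x)`, written `chY x y` -/
  chY : X → Y → ℝ
  /-- `P_{Z|X}(z|x)`, written `chZ x z` -/
  chZ : X → Z → ℝ
  pX_mem : pX ∈ stdSimplex ℝ X
  chY_mem : ∀ x, chY x ∈ stdSimplex ℝ Y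
  chZ_mem : ∀ x, chZ x ∈ stdSimplex ℝ Z

/-- A deterministic identification function: from the `M` enrolled sequences
`y^n(1), …, y^n(M)` and the observation `z^n` it produces an estimate of the index. -/
abbrev BioDecoder (Y Z : Type*) (n M : ℕ) : Type _ :=
  (Fin M → Fin n → Y) → (Fin n → Z) → Fin M

noncomputable section

namespace BioModel

variable {X Y Z : Type*} [Fintype X] [Fintype Y] [Fintype Z] (S : BioModel X Y Z)

/-- `P_{YZ}(y,z)`, the marginal of `P_X × P_{Y|X} × P_{Z|X}`. -/
def pYZ (y : Y) (z : Z) : ℝ := ∑ x, S.pX x * S.chY x y * S.chZ x z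

/-- `P_Y(y)`. -/
def pY (y : Y) : ℝ := ∑ x, S.pX x * S.chY x y

/-- `P_Z(z)`. -/
def pZ (z : Z) : ℝ := ∑ x, S.pX x * S.chZ x z

/-- `P_{Z|Y}(z|y)`; only values with `P_Y(y) > 0` matter below. -/
def chZY (y : Y) (z : Z) : ℝ := S.pYZ y z / S.pY y

/-- The information density `log (P_{Z|Y}(z|y) / P_Z(z))`. It is only ever weighted by
`P_{YZ}(y,z)`, so that its value where `P_{YZ}(y,z) = 0` is immaterial. -/
def infoDensity (y : Y) (z : Z) : ℝ := Real.log (S.chZY y z / S.pZ z)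

/-- The expectation of the information density under `P_{YZ}`. -/
def infoMean : ℝ := ∑ y, ∑ z, S.pYZ y z * S.infoDensity y z

/-- The (unconditional) variance `V` of the information density under `P_{YZ}`. -/
def infoVariance : ℝ := ∑ y, ∑ z, S.pYZ y z * (S.infoDensity y z - S.infoMean) ^ 2

/-- The joint probability of: feature vectors `x^n(1..M)` i.i.d. from `P_X^n`, their enrolled
noisy versions `y^n(1..M)`, an independent uniform index `w`, and the observation `z^n`, the
output of the channel `P_{Z|X}` on input `x^n(w)`. -/
def jointProb {n M : ℕ} (x : Fin M → Fin n → X) (y : Fin M → Fin n → Y) (w : Fin M)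
    (z : Fin n → Z) : ℝ :=
  (∏ m, ((∏ i, S.pX (x m i)) * ∏ i, S.chY (x m i) (y m i))) *
    ((1 / (M : ℝ)) * ∏ i, S.chZ (x w i) (z i))

/-- The probability of correct identification `Pr{g(Y^n(1),…,Y^n(M),Z^n) = W}`. -/
def probCorrect {n M : ℕ} (g : BioDecoder Y Z n M) : ℝ :=
  ∑ x : Fin M → Fin n → X, ∑ y : Fin M → Fin n → Y, ∑ w : Fin M, ∑ z : Fin n → Z,
    if g y z = w then S.jointProb x y w z else 0

/-- The error probability `Pr{g(Y^n(1),…,Y^n(M),Z^n) ≠ W}`. -/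
def probError {n M : ℕ} (g : BioDecoder Y Z n M) : ℝ :=
  ∑ x : Fin M → Fin n → X, ∑ y : Fin M → Fin n → Y, ∑ w : Fin M, ∑ z : Fin n → Z,
    if g y z ≠ w then S.jointProb x y w z else 0

/-- `P_c^*(n, R)`: the largest probability of correct identification over all numbers of items
`M ≥ 1` with `log M ≥ n R` and all identification functions. -/
def maxProbCorrect (n : ℕ) (R : ℝ) : ℝ :=
  sSup {p : ℝ | ∃ M : ℕ, 1 ≤ M ∧ (n : ℝ) * R ≤ Real.log (M : ℝ) ∧
    ∃ g : BioDecoder Y Z n M, p = S.probCorrect g}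

/-- The rate `R` is `ε`-achievable: for some numbers of items `M_n` and identification functions
`g_n`, `liminf (1/n) log M_n ≥ R` and `limsup P_e(g_n) ≤ ε` (both limits in the extended reals). -/
def IsAchievable (ε R : ℝ) : Prop :=
  ∃ (M : ℕ → ℕ) (g : ∀ n, BioDecoder Y Z n (M n)), (∀ n, 1 ≤ M n) ∧
    (R : EReal) ≤ liminf (fun n => ((Real.log (M n : ℝ) / (n : ℝ) : ℝ) : EReal)) atTop ∧
    limsup (fun n => ((S.probError (g n) : ℝ) : EReal)) atTop ≤ (ε : EReal)

/-- The capacity `C_bio`: the supremum of the rates that lie, for every `ε ∈ (0,1)`, in the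
closure of the set of `ε`-achievable rates. -/
def capacity : ℝ :=
  sSup (⋂ ε ∈ Set.Ioo (0 : ℝ) 1, closure {R : ℝ | S.IsAchievable ε R})

end BioModel

end

/-! Summing out the features leaves a test: the true entry and the observation have law `P_YZ^n`,
while every other entry is independent of the observation. Two one-shot bounds control the success
probability by the tail of the information density alone. The converse `successProb_le` gives Pc ≤
P(i > t) + exp(t)/M for every decoder. The threshold decoder of `exists_le_successProb` gives Pc ≥
P(i > t)(1 - M exp(-t)).

The density of `n` letters is an i.i.d. sum with mean the mutual information I and variance V.
Chebyshev's inequality at fixed distance from I shows that the capacity is I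
(`capacity_eq_infoMean`). At rate I ± ξ the threshold is placed near n(I ± aξ), with `a` on the
appropriate side of 1. The penalty exp(-n|1-a|ξ) is negligible at the scale exp(-nξ²), since ξ → 0,
and the tail has exponent a²/(2V) by the moderate deviation bounds `eventually_upperTail_le` and
`eventually_le_upperTail`. Letting a → 1 gives 1/(2V) on both sides of capacity.

For bounded variables the moderate deviation bounds need only Taylor expansions of the moment
generating function: a Chernoff bound from above, exponential tilting with Chebyshev from below. -/

namespace Identification

/-! ### One-shot identification bounds -/

variable {A B : Type*} [Fintype A] [Fintype B]

lemma sum_mul_prod_erase {M : ℕ} (p : A → ℝ) (hp : ∑ a, p a = 1) (F : A → ℝ) (w : Fin M) :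
    ∑ y : Fin M → A, F (y w) * ∏ m ∈ Finset.univ.erase w, p (y m) = ∑ a, F a := by
  have h : ∀ y : Fin M → A, F (y w) * ∏ m ∈ Finset.univ.erase w, p (y m)
      = ∏ m, (if m = w then F else p) (y m) := by
    intro y
    rw [← Finset.mul_prod_erase Finset.univ _ (Finset.mem_univ w), if_pos rfl]
    congr 1
    refine Finset.prod_congr rfl fun m hm => ?_
    rw [if_neg (Finset.ne_of_mem_erase hm)]
  simp_rw [h]
  rw [← Fintype.prod_sum (fun m a => (if m = w then F else p) a), Fintype.prod_eq_single w]
  · simp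
  · intro m hm
    simp [hm, hp]

lemma sum_mul_mul_prod_erase {M : ℕ} (p : A → ℝ) (hp : ∑ a, p a = 1) (F G : A → ℝ)
    {w k : Fin M} (hk : k ≠ w) :
    ∑ y : Fin M → A, F (y w) * (G (y k) * ∏ m ∈ Finset.univ.erase w, p (y m))
      = (∑ a, F a) * ∑ a, G a * p a := by
  have hkm : k ∈ Finset.univ.erase w := by simp [hk]
  have h : ∀ y : Fin M → A, F (y w) * (G (y k) * ∏ m ∈ Finset.univ.erase w, p (y m))
      = ∏ m, (if m = w then F else if m = k then fun a => G a * p a else p) (y m) := by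
    intro y
    rw [← Finset.mul_prod_erase Finset.univ _ (Finset.mem_univ w), if_pos rfl]
    congr 1
    rw [← Finset.mul_prod_erase _ _ hkm, ← Finset.mul_prod_erase _ _ hkm, if_neg hk, if_pos rfl,
      ← mul_assoc]
    congr 1
    refine Finset.prod_congr rfl fun m hm => ?_
    rw [if_neg (Finset.ne_of_mem_erase (Finset.mem_of_mem_erase hm)),
      if_neg (Finset.ne_of_mem_erase hm)]
  simp_rw [h]
  rw [← Fintype.prod_sum
      (fun m a => (if m = w then F else if m = k then fun a => G a * p a else p) a),
    ← Finset.mul_prod_erase Finset.univ _ (Finset.mem_univ w), ← Finset.mul_prod_erase _ _ hkm,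
    Finset.prod_eq_one]
  · simp [hk]
  · intro m hm
    simp [Finset.ne_of_mem_erase (Finset.mem_of_mem_erase hm), Finset.ne_of_mem_erase hm, hp]

/-- The success probability of the identification function `g`, when the entry of the true item
and the observation have joint law `q` and all other entries are independent with law `p`. -/
noncomputable def successProb (q : A → B → ℝ) (p : A → ℝ) {M : ℕ}
    (g : (Fin M → A) → B → Fin M) : ℝ :=
  ∑ y : Fin M → A, ∑ w : Fin M, ∑ z : B, if g y z = w then
    (1 / (M : ℝ)) * (q (y w) z * ∏ m ∈ Finset.univ.erase w, p (y m)) else 0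

/-- The part of `q` where its density with respect to `p × r` exceeds `exp t`. -/
noncomputable def above (q : A → B → ℝ) (p : A → ℝ) (r : B → ℝ) (t : ℝ) (a : A) (b : B) : ℝ :=
  if Real.exp t * (p a * r b) < q a b then q a b else 0

variable {q : A → B → ℝ} {p : A → ℝ} {r : B → ℝ}

/-- Split q ≤ `above` + exp(t)·p×r. Under p×r the observation is independent of all entries, so any
decoder whatsoever is correct with probability exactly 1/M. -/
lemma successProb_le (hp : ∀ a, 0 ≤ p a) (hr : ∀ b, 0 ≤ r b)
    (hp1 : ∑ a, p a = 1) (hr1 : ∑ b, r b = 1) (hq : ∀ a b, 0 ≤ q a b) (t : ℝ) {M : ℕ} (hM : 1 ≤ M)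
    (g : (Fin M → A) → B → Fin M) :
    successProb q p g ≤ ∑ b, ∑ a, above q p r t a b + Real.exp t / M := by
  have hM0 : (0 : ℝ) < M := by exact_mod_cast hM
  have key : ∀ (y : Fin M → A) (w : Fin M) (z : B),
      (if g y z = w then
        (1 / (M : ℝ)) * (q (y w) z * ∏ m ∈ Finset.univ.erase w, p (y m)) else 0)
      ≤ (1 / (M : ℝ)) * (above q p r t (y w) z * ∏ m ∈ Finset.univ.erase w, p (y m))
        + if g y z = w then Real.exp t / M * ((∏ m, p (y m)) * r z) else 0 := by
    intro y w z
    have hP : 0 ≤ ∏ m ∈ Finset.univ.erase w, p (y m) := Finset.prod_nonneg fun _ _ => hp _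
    have hab : 0 ≤ above q p r t (y w) z := by
      unfold above; split_ifs
      · exact hq _ _
      · exact le_rfl
    have h0 : 0 ≤ (1 / (M : ℝ)) *
        (above q p r t (y w) z * ∏ m ∈ Finset.univ.erase w, p (y m)) := by positivity
    split_ifs with hg
    · have hle : q (y w) z ≤ above q p r t (y w) z + Real.exp t * (p (y w) * r z) := by
        unfold above; split_ifs with h
        · have := hp (y w); have := hr z
          have : 0 ≤ Real.exp t * (p (y w) * r z) := by positivity
          linarith
        · linarith [not_lt.1 h]
      rw [← Finset.mul_prod_erase Finset.univ (fun m => p (y m)) (Finset.mem_univ w)]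
      calc _ ≤ (1 / (M : ℝ)) * ((above q p r t (y w) z + Real.exp t * (p (y w) * r z))
              * ∏ m ∈ Finset.univ.erase w, p (y m)) := by gcongr
        _ = _ := by ring
    · simpa using h0
  calc successProb q p g ≤ ∑ y : Fin M → A, ∑ w : Fin M, ∑ z : B,
        ((1 / (M : ℝ)) * (above q p r t (y w) z * ∏ m ∈ Finset.univ.erase w, p (y m))
        + if g y z = w then Real.exp t / M * ((∏ m, p (y m)) * r z) else 0) :=
        Finset.sum_le_sum fun y _ => Finset.sum_le_sum fun w _ => Finset.sum_le_sum fun z _ =>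
          key y w z
    _ = _ := by
      simp_rw [Finset.sum_add_distrib]
      congr 1
      · rw [Finset.sum_comm]
        simp_rw [Finset.sum_comm (s := (Finset.univ : Finset (Fin M → A))), ← Finset.mul_sum]
        have : ∀ (w : Fin M) (z : B), ∑ y : Fin M → A, above q p r t (y w) z *
            ∏ m ∈ Finset.univ.erase w, p (y m) = ∑ a, above q p r t a z := fun w z =>
          sum_mul_prod_erase p hp1 (fun a => above q p r t a z) w
        simp_rw [this]
        rw [Finset.sum_const, Finset.card_univ, Fintype.card_fin, nsmul_eq_mul]
        field_simp
      · have : ∀ y : Fin M → A, ∑ w : Fin M, ∑ z : B,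
            (if g y z = w then Real.exp t / M * ((∏ m, p (y m)) * r z) else 0)
            = Real.exp t / M * ∏ m, p (y m) := by
          intro y
          rw [Finset.sum_comm]
          simp_rw [Finset.sum_ite_eq, Finset.mem_univ, if_true, ← Finset.mul_sum, hr1, mul_one]
        simp_rw [this, ← Finset.mul_sum]
        rw [← Fintype.prod_sum (fun _ a => p a)]
        simp [hp1]

/-- The decoder returns an entry passing the threshold, and is right when the true entry passes and
no other does. Given the observation, true and false entries are independent, so the union bound
yields a factor rather than a subtracted term. Above capacity this matters, because there the main
term is itself exponentially small. -/
lemma exists_le_successProb (hp : ∀ a, 0 ≤ p a) (hp1 : ∑ a, p a = 1) (hr : ∀ b, 0 ≤ r b)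
    (hq : ∀ a b, 0 ≤ q a b) (hqr : ∀ b, ∑ a, q a b = r b) (t : ℝ) {M : ℕ} (hM : 1 ≤ M) :
    ∃ g : (Fin M → A) → B → Fin M,
      (∑ b, ∑ a, above q p r t a b) * (1 - M * Real.exp (-t)) ≤ successProb q p g := by
  classical
  have hM0 : (0 : ℝ) < M := by exact_mod_cast hM
  let T : A → B → Prop := fun a b => Real.exp t * (p a * r b) < q a b
  let g : (Fin M → A) → B → Fin M := fun y z =>
    if h : ∃ m, T (y m) z then h.choose else ⟨0, hM⟩
  have hg : ∀ y z w, T (y w) z → (∀ m ∈ Finset.univ.erase w, ¬ T (y m) z) → g y z = w := by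
    intro y z w hw hm
    have h : ∃ m, T (y m) z := ⟨w, hw⟩
    have hc := h.choose_spec
    simp only [g, dif_pos h]
    by_contra hne
    exact hm _ (by simp [hne]) hc
  refine ⟨g, ?_⟩
  have hab : ∀ a z, 0 ≤ above q p r t a z := by
    intro a z
    unfold above; split_ifs
    · exact hq _ _
    · exact le_rfl
  let G : B → A → ℝ := fun z a => if T a z then 1 else 0
  have hG : ∀ z a, 0 ≤ G z a := fun z a => by dsimp [G]; split_ifs <;> norm_num
  -- Pointwise union bound: if the decoder errs, either the true entry fails, so `above` vanishes,
  -- or some false entry passes and its term cancels the first one.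
  have key : ∀ (y : Fin M → A) (w : Fin M) (z : B),
      (1 / (M : ℝ)) * (above q p r t (y w) z * ∏ m ∈ Finset.univ.erase w, p (y m)
        - ∑ k ∈ Finset.univ.erase w,
          above q p r t (y w) z * (G z (y k) * ∏ m ∈ Finset.univ.erase w, p (y m)))
      ≤ (if g y z = w then
        (1 / (M : ℝ)) * (q (y w) z * ∏ m ∈ Finset.univ.erase w, p (y m)) else 0) := by
    intro y w z
    have hP : 0 ≤ ∏ m ∈ Finset.univ.erase w, p (y m) := Finset.prod_nonneg fun _ _ => hp _
    have hS : 0 ≤ ∑ k ∈ Finset.univ.erase w,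
          above q p r t (y w) z * (G z (y k) * ∏ m ∈ Finset.univ.erase w, p (y m)) :=
      Finset.sum_nonneg fun k _ => mul_nonneg (hab _ _) (mul_nonneg (hG _ _) hP)
    have hle : above q p r t (y w) z ≤ q (y w) z := by
      unfold above; split_ifs
      · exact le_rfl
      · exact hq _ _
    by_cases hgw : g y z = w
    · rw [if_pos hgw]
      have : above q p r t (y w) z * ∏ m ∈ Finset.univ.erase w, p (y m) ≤
        q (y w) z * ∏ m ∈ Finset.univ.erase w, p (y m) := by gcongr
      gcongr
      linarith
    · rw [if_neg hgw]
      refine mul_nonpos_of_nonneg_of_nonpos (by positivity) ?_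
      by_cases hT : T (y w) z
      · have : ∃ k ∈ Finset.univ.erase w, T (y k) z := by
          by_contra hcon
          push Not at hcon
          exact hgw (hg y z w hT hcon)
        obtain ⟨k, hk, hTk⟩ := this
        have h1 := Finset.single_le_sum (f := fun k => above q p r t (y w) z *
          (G z (y k) * ∏ m ∈ Finset.univ.erase w, p (y m)))
          (fun k _ => mul_nonneg (hab _ _) (mul_nonneg (hG _ _) hP)) hk
        have h2 : G z (y k) = 1 := if_pos hTk
        simp only [h2, one_mul] at h1
        linarith
      · have : above q p r t (y w) z = 0 := if_neg hT
        simp [this]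
  -- Change of measure given z: on the passing set p < exp(-t)·q/r, and q/r sums to one over the
  -- entries. If r vanishes at z, so does the whole column of q.
  have hGle : ∀ z, (∑ a, above q p r t a z) * ∑ a, G z a * p a
      ≤ (∑ a, above q p r t a z) * Real.exp (-t) := by
    intro z
    rcases (hr z).eq_or_lt with h0 | hpos
    · have : ∑ a, above q p r t a z = 0 := by
        refine Finset.sum_eq_zero fun a _ => ?_
        have hqz : q a z = 0 := by
          have := hqr z
          rw [← h0, Finset.sum_eq_zero_iff_of_nonneg fun a _ => hq a z] at this
          exact this a (Finset.mem_univ a)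
        simp [above, hqz]
      simp [this]
    · refine mul_le_mul_of_nonneg_left ?_ (Finset.sum_nonneg fun a _ => hab a z)
      have : ∀ a, G z a * p a ≤ Real.exp (-t) * (q a z / r z) := by
        intro a
        by_cases hT : T a z
        · have h1 : G z a = 1 := if_pos hT
          have h2 : Real.exp t * (p a * r z) < q a z := hT
          rw [h1, one_mul, Real.exp_neg, ← div_eq_inv_mul, div_div, le_div_iff₀ (by positivity)]
          linarith
        · have h1 : G z a = 0 := if_neg hT
          rw [h1, zero_mul]
          have := hq a z
          positivity
      calc ∑ a, G z a * p a ≤ ∑ a, Real.exp (-t) * (q a z / r z) :=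
            Finset.sum_le_sum fun a _ => this a
        _ = Real.exp (-t) := by
            rw [← Finset.mul_sum, ← Finset.sum_div, hqr z, div_self hpos.ne', mul_one]
  calc (∑ b, ∑ a, above q p r t a b) * (1 - M * Real.exp (-t))
      ≤ ∑ w : Fin M, ∑ z : B, (1 / (M : ℝ)) * (∑ a, above q p r t a z
          - ∑ k ∈ Finset.univ.erase w, (∑ a, above q p r t a z) * ∑ a, G z a * p a) := by
        have : ∀ (w : Fin M) (z : B), (1 / (M : ℝ)) *
            ((∑ a, above q p r t a z) * (1 - M * Real.exp (-t)))
            ≤ (1 / (M : ℝ)) * (∑ a, above q p r t a z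
          - ∑ k ∈ Finset.univ.erase w, (∑ a, above q p r t a z) * ∑ a, G z a * p a) := by
          intro w z
          refine mul_le_mul_of_nonneg_left ?_ (by positivity)
          rw [Finset.sum_const, Finset.card_erase_of_mem (Finset.mem_univ w), Finset.card_univ,
            Fintype.card_fin, nsmul_eq_mul, Nat.cast_sub hM, Nat.cast_one]
          have hs : 0 ≤ ∑ a, above q p r t a z := Finset.sum_nonneg fun a _ => hab a z
          have hM1 : (1 : ℝ) ≤ M := by exact_mod_cast hM
          have h1 := mul_le_mul_of_nonneg_left (hGle z) (sub_nonneg.2 hM1)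
          have h2 : 0 ≤ (∑ a, above q p r t a z) * Real.exp (-t) := by positivity
          nlinarith
        calc _ = ∑ w : Fin M, ∑ z : B, (1 / (M : ℝ)) *
            ((∑ a, above q p r t a z) * (1 - M * Real.exp (-t))) := by
              rw [Finset.sum_const, Finset.card_univ, Fintype.card_fin, nsmul_eq_mul,
                ← Finset.mul_sum, ← Finset.sum_mul]
              field_simp
          _ ≤ _ := Finset.sum_le_sum fun w _ => Finset.sum_le_sum fun z _ => this w z
    _ = ∑ y : Fin M → A, ∑ w : Fin M, ∑ z : B,
        (1 / (M : ℝ)) * (above q p r t (y w) z * ∏ m ∈ Finset.univ.erase w, p (y m)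
        - ∑ k ∈ Finset.univ.erase w,
          above q p r t (y w) z * (G z (y k) * ∏ m ∈ Finset.univ.erase w, p (y m))) := by
        symm
        rw [Finset.sum_comm]
        refine Finset.sum_congr rfl fun w _ => ?_
        rw [Finset.sum_comm]
        refine Finset.sum_congr rfl fun z _ => ?_
        rw [← Finset.mul_sum, Finset.sum_sub_distrib,
          sum_mul_prod_erase p hp1 (fun a => above q p r t a z) w, Finset.sum_comm]
        congr 2
        refine Finset.sum_congr rfl fun k hk => ?_
        exact sum_mul_mul_prod_erase p hp1 (fun a => above q p r t a z) (G z)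
          (Finset.ne_of_mem_erase hk)
    _ ≤ successProb q p g :=
        Finset.sum_le_sum fun y _ => Finset.sum_le_sum fun w _ => Finset.sum_le_sum fun z _ =>
          key y w z

end Identification

/-! ### Tails of i.i.d. sums on a finite space -/

namespace FiniteIID

variable {Ω : Type*} [Fintype Ω] {p U : Ω → ℝ}

/-- The probability that the sum of `U` over `n` independent samples from `p` is at least `t`. -/
noncomputable def upperTail (p U : Ω → ℝ) (n : ℕ) (t : ℝ) : ℝ :=
  ∑ ω : Fin n → Ω, if t ≤ ∑ i, U (ω i) then ∏ i, p (ω i) else 0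

lemma sum_prod_eq_pow (f : Ω → ℝ) (n : ℕ) :
    ∑ ω : Fin n → Ω, ∏ i, f (ω i) = (∑ a, f a) ^ n :=
  (Fintype.sum_pow f n).symm

lemma upperTail_anti (hp : ∀ a, 0 ≤ p a) (n : ℕ) {t t' : ℝ} (h : t ≤ t') :
    upperTail p U n t' ≤ upperTail p U n t := by
  refine Finset.sum_le_sum fun ω _ => ?_
  have := Finset.prod_nonneg fun i (_ : i ∈ (Finset.univ : Finset (Fin n))) => hp (ω i)
  split_ifs with h1 h2 h2
  · exact le_rfl
  · exact absurd (h.trans h1) h2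
  · exact this
  · exact le_rfl

/-- Chernoff: the indicator is at most exp(s(ΣU - t)), whose expectation factorizes. -/
lemma upperTail_le_exp_mul (hp : ∀ a, 0 ≤ p a) (n : ℕ) (t : ℝ) {s : ℝ} (hs : 0 ≤ s) :
    upperTail p U n t ≤ Real.exp (-(s * t)) * (∑ a, p a * Real.exp (s * U a)) ^ n := by
  rw [← sum_prod_eq_pow, Finset.mul_sum]
  refine Finset.sum_le_sum fun ω _ => ?_
  have h0 := Finset.prod_nonneg fun i (_ : i ∈ (Finset.univ : Finset (Fin n))) => hp (ω i)
  rw [Finset.prod_mul_distrib, ← Real.exp_sum, ← Finset.mul_sum, mul_left_comm, ← Real.exp_add]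
  split_ifs with h
  · refine le_mul_of_one_le_right h0 (Real.one_le_exp ?_)
    nlinarith
  · positivity

lemma sum_fin_succ (n : ℕ) (f : (Fin (n + 1) → Ω) → ℝ) :
    ∑ ω, f ω = ∑ a, ∑ ω : Fin n → Ω, f (Fin.cons a ω) := by
  rw [← Fintype.sum_prod_type', ← (Fin.consEquiv fun _ : Fin (n + 1) => Ω).sum_comp]
  rfl

lemma sum_prod_mul_sq (hp1 : ∑ a, p a = 1) (hU : ∑ a, p a * U a = 0) (n : ℕ) :
    ∑ ω : Fin n → Ω, (∏ i, p (ω i)) * (∑ i, U (ω i)) ^ 2 = n * ∑ a, p a * U a ^ 2 := by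
  induction n with
  | zero => simp
  | succ n ih =>
    rw [sum_fin_succ]
    simp only [Fin.prod_univ_succ, Fin.sum_univ_succ, Fin.cons_zero, Fin.cons_succ]
    have : ∀ a, ∑ ω : Fin n → Ω, p a * (∏ i, p (ω i)) * (U a + ∑ i, U (ω i)) ^ 2
        = p a * U a ^ 2 + p a * U a * (2 * ∑ ω : Fin n → Ω, (∏ i, p (ω i)) * ∑ i, U (ω i))
          + p a * (n * ∑ a, p a * U a ^ 2) := by
      intro a
      have h1 : ∑ ω : Fin n → Ω, ∏ i, p (ω i) = 1 := by rw [sum_prod_eq_pow, hp1, one_pow]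
      rw [← ih, Finset.mul_sum, Finset.mul_sum, Finset.mul_sum,
        ← mul_one (p a * U a ^ 2), ← h1, Finset.mul_sum, ← Finset.sum_add_distrib,
        ← Finset.sum_add_distrib]
      exact Finset.sum_congr rfl fun ω _ => by ring
    simp_rw [this]
    rw [Finset.sum_add_distrib, Finset.sum_add_distrib, ← Finset.sum_mul, ← Finset.sum_mul, hU,
      hp1]
    push_cast
    ring

lemma sum_prod_abs_ge_le (hp : ∀ a, 0 ≤ p a) (hp1 : ∑ a, p a = 1) (hU : ∑ a, p a * U a = 0)
    (n : ℕ) {h : ℝ} (hh : 0 < h) :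
    ∑ ω : Fin n → Ω, (if h ≤ |∑ i, U (ω i)| then ∏ i, p (ω i) else 0)
      ≤ n * (∑ a, p a * U a ^ 2) / h ^ 2 := by
  rw [← sum_prod_mul_sq hp1 hU, Finset.sum_div]
  refine Finset.sum_le_sum fun ω _ => ?_
  have h0 := Finset.prod_nonneg fun i (_ : i ∈ (Finset.univ : Finset (Fin n))) => hp (ω i)
  split_ifs with hc
  · rw [le_div_iff₀ (by positivity)]
    refine mul_le_mul_of_nonneg_left ?_ h0
    rw [← sq_abs (∑ i, U (ω i))]
    gcongr
  · positivity

lemma upperTail_le_variance_div (hp : ∀ a, 0 ≤ p a) (hp1 : ∑ a, p a = 1)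
    (hU : ∑ a, p a * U a = 0) (n : ℕ) {h : ℝ} (hh : 0 < h) :
    upperTail p U n h ≤ n * (∑ a, p a * U a ^ 2) / h ^ 2 := by
  refine le_trans (Finset.sum_le_sum fun ω _ => ?_) (sum_prod_abs_ge_le hp hp1 hU n hh)
  have h0 := Finset.prod_nonneg fun i (_ : i ∈ (Finset.univ : Finset (Fin n))) => hp (ω i)
  split_ifs with h1 h2 h2
  · exact le_rfl
  · exact absurd (h1.trans (le_abs_self _)) h2
  · exact h0
  · exact le_rfl

/-- Lower bound for the tail by exponential tilting and Chebyshev's inequality. -/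
lemma le_upperTail_of_tilt (hp : ∀ a, 0 ≤ p a) {s φ μ v h : ℝ} (hs : 0 ≤ s)
    (hφ : ∑ a, p a * Real.exp (s * U a) = φ) (hφ0 : 0 < φ)
    (hμ : ∑ a, p a * Real.exp (s * U a) * U a = φ * μ) (hv : ∀ a, (U a - μ) ^ 2 ≤ v)
    (hh : 0 < h) (n : ℕ) :
    φ ^ n * Real.exp (-(s * (n * μ + h))) * (1 - n * v / h ^ 2) ≤
      upperTail p U n (n * μ - h) := by
  -- The tilted law, under which U has mean μ.
  set Q : Ω → ℝ := fun a => p a * Real.exp (s * U a) / φ with hQdef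
  have hQ : ∀ a, 0 ≤ Q a := fun a => by have := hp a; positivity
  have hQ1 : ∑ a, Q a = 1 := by
    rw [hQdef, ← Finset.sum_div, hφ, div_self hφ0.ne']
  have hQU : ∑ a, Q a * (U a - μ) = 0 := by
    have : ∑ a, Q a * U a = μ := by
      have : ∀ a, Q a * U a = p a * Real.exp (s * U a) * U a / φ := fun a => by
        rw [hQdef]; ring
      simp_rw [this]
      rw [← Finset.sum_div, hμ, mul_div_cancel_left₀ _ hφ0.ne']
    simp_rw [mul_sub]
    rw [Finset.sum_sub_distrib, this, ← Finset.sum_mul, hQ1, one_mul, sub_self]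
  have hcheb := sum_prod_abs_ge_le hQ hQ1 hQU n hh
  have hvar : ∑ a, Q a * (U a - μ) ^ 2 ≤ v := by
    calc _ ≤ ∑ a, Q a * v := Finset.sum_le_sum fun a _ =>
          mul_le_mul_of_nonneg_left (hv a) (hQ a)
      _ = v := by rw [← Finset.sum_mul, hQ1, one_mul]
  have hwin : 1 - n * v / h ^ 2 ≤ ∑ ω : Fin n → Ω,
      (if |∑ i, (U (ω i) - μ)| < h then ∏ i, Q (ω i) else 0) := by
    have htot : ∑ ω : Fin n → Ω, (if |∑ i, (U (ω i) - μ)| < h then ∏ i, Q (ω i) else 0)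
        + ∑ ω : Fin n → Ω, (if h ≤ |∑ i, (U (ω i) - μ)| then ∏ i, Q (ω i) else 0) = 1 := by
      rw [← Finset.sum_add_distrib]
      calc _ = ∑ ω : Fin n → Ω, ∏ i, Q (ω i) := Finset.sum_congr rfl fun ω _ => by
            by_cases hc : h ≤ |∑ i, (U (ω i) - μ)|
            · rw [if_neg (not_lt.2 hc), if_pos hc, zero_add]
            · rw [if_pos (not_le.1 hc), if_neg hc, add_zero]
        _ = 1 := by rw [sum_prod_eq_pow, hQ1, one_pow]
    have : n * (∑ a, Q a * (U a - μ) ^ 2) / h ^ 2 ≤ n * v / h ^ 2 := by gcongr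
    linarith
  refine (mul_le_mul_of_nonneg_left hwin (by positivity)).trans ?_
  rw [Finset.mul_sum]
  refine Finset.sum_le_sum fun ω _ => ?_
  have h0 := Finset.prod_nonneg fun i (_ : i ∈ (Finset.univ : Finset (Fin n))) => hp (ω i)
  by_cases hc : |∑ i, (U (ω i) - μ)| < h
  · rw [if_pos hc]
    rw [Finset.sum_sub_distrib, Finset.sum_const, Finset.card_univ, Fintype.card_fin,
      nsmul_eq_mul, abs_lt] at hc
    rw [if_pos (by linarith)]
    -- On the window ΣU < nμ + h, so the density of Q^n relative to p^n is at most exp(s(nμ +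
    -- h))/φ^n; this transfers Chebyshev's bound under Q back to p.
    have : ∏ i, Q (ω i) = (∏ i, p (ω i)) * Real.exp (s * ∑ i, U (ω i)) / φ ^ n := by
      simp only [hQdef]
      rw [Finset.prod_div_distrib, Finset.prod_mul_distrib, ← Real.exp_sum, ← Finset.mul_sum]
      simp
    rw [this]
    calc _ = (∏ i, p (ω i)) * (Real.exp (-(s * (n * μ + h))) * Real.exp (s * ∑ i, U (ω i))) := by
          field_simp
      _ ≤ (∏ i, p (ω i)) * 1 := by
          refine mul_le_mul_of_nonneg_left ?_ h0
          rw [← Real.exp_add, Real.exp_le_one_iff]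
          nlinarith
      _ = _ := mul_one _
  · rw [if_neg hc, mul_zero]
    split_ifs
    · exact h0
    · exact le_rfl

lemma abs_exp_sub_quadratic_le {x : ℝ} (hx : |x| ≤ 1) :
    |Real.exp x - 1 - x - x ^ 2 / 2| ≤ |x| ^ 3 := by
  have h := Real.exp_bound hx (n := 3) (by norm_num)
  simp only [Finset.sum_range_succ, Finset.sum_range_zero] at h
  norm_num [Nat.factorial] at h
  have h2 : Real.exp x - 1 - x - x ^ 2 / 2 = Real.exp x - (1 + x + x ^ 2 / 2) := by ring
  rw [h2]
  have : 0 ≤ |x| ^ 3 := by positivity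
  linarith

/-! ### Small-parameter expansion of the moment generating function -/

section Moments

variable {V B s : ℝ}

lemma abs_sum_mul_le
    (hp : ∀ a, 0 ≤ p a) (hp1 : ∑ a, p a = 1) {f : Ω → ℝ} {K : ℝ} (hf : ∀ a, |f a| ≤ K) :
    |∑ a, p a * f a| ≤ K := by
  calc |∑ a, p a * f a| ≤ ∑ a, |p a * f a| := Finset.abs_sum_le_sum_abs _ _
    _ ≤ ∑ a, p a * K := Finset.sum_le_sum fun a _ => by
        rw [abs_mul, abs_of_nonneg (hp a)]
        exact mul_le_mul_of_nonneg_left (hf a) (hp a)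
    _ = K := by rw [← Finset.sum_mul, hp1, one_mul]

lemma abs_mul_le {Ω : Type*} {U : Ω → ℝ}
    (hB : ∀ a, |U a| ≤ B) (hs : 0 ≤ s) (a : Ω) : |s * U a| ≤ s * B := by
  rw [abs_mul, abs_of_nonneg hs]
  exact mul_le_mul_of_nonneg_left (hB a) hs

lemma abs_mgf_sub_le
    (hp : ∀ a, 0 ≤ p a) (hp1 : ∑ a, p a = 1) (hU : ∑ a, p a * U a = 0)
    (hV : ∑ a, p a * U a ^ 2 = V) (hB : ∀ a, |U a| ≤ B) (hs : 0 ≤ s) (hsB : s * B ≤ 1) :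
    |∑ a, p a * Real.exp (s * U a) - 1 - s ^ 2 * V / 2| ≤ (s * B) ^ 3 := by
  have h : ∑ a, p a * Real.exp (s * U a) - 1 - s ^ 2 * V / 2
      = ∑ a, p a * (Real.exp (s * U a) - 1 - s * U a - (s * U a) ^ 2 / 2) := by
    have : ∀ a, p a * (Real.exp (s * U a) - 1 - s * U a - (s * U a) ^ 2 / 2)
        = p a * Real.exp (s * U a) - p a - s * (p a * U a) - s ^ 2 / 2 * (p a * U a ^ 2) :=
      fun a => by ring
    simp_rw [this, Finset.sum_sub_distrib, ← Finset.mul_sum, hp1, hU, hV]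
    ring
  rw [h]
  refine abs_sum_mul_le hp hp1 fun a => ?_
  have h1 := abs_mul_le hB hs a
  exact (abs_exp_sub_quadratic_le (h1.trans hsB)).trans (pow_le_pow_left₀ (abs_nonneg _) h1 3)

lemma one_le_mgf
    (hp : ∀ a, 0 ≤ p a) (hp1 : ∑ a, p a = 1) (hU : ∑ a, p a * U a = 0) :
    1 ≤ ∑ a, p a * Real.exp (s * U a) := by
  calc 1 = ∑ a, p a * (s * U a + 1) := by
        have : ∀ a, p a * (s * U a + 1) = s * (p a * U a) + p a := fun a => by ring
        simp_rw [this, Finset.sum_add_distrib, ← Finset.mul_sum, hU, hp1]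
        ring
    _ ≤ _ := Finset.sum_le_sum fun a _ =>
        mul_le_mul_of_nonneg_left (Real.add_one_le_exp _) (hp a)

lemma mgf_le
    (hp : ∀ a, 0 ≤ p a) (hp1 : ∑ a, p a = 1) (hU : ∑ a, p a * U a = 0) (hB : ∀ a, |U a| ≤ B)
    (hs : 0 ≤ s) (hsB : s * B ≤ 1) : ∑ a, p a * Real.exp (s * U a) ≤ 1 + (s * B) ^ 2 := by
  have h : ∑ a, p a * Real.exp (s * U a) - 1
      = ∑ a, p a * (Real.exp (s * U a) - 1 - s * U a) := by
    have : ∀ a, p a * (Real.exp (s * U a) - 1 - s * U a)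
        = p a * Real.exp (s * U a) - p a - s * (p a * U a) := fun a => by ring
    simp_rw [this, Finset.sum_sub_distrib, ← Finset.mul_sum, hp1, hU]
    ring
  have h2 : |∑ a, p a * (Real.exp (s * U a) - 1 - s * U a)| ≤ (s * B) ^ 2 := by
    refine abs_sum_mul_le hp hp1 fun a => ?_
    have h1 := abs_mul_le hB hs a
    refine (Real.abs_exp_sub_one_sub_id_le (h1.trans hsB)).trans ?_
    rw [← sq_abs]
    exact pow_le_pow_left₀ (abs_nonneg _) h1 2
  linarith [le_abs_self (∑ a, p a * (Real.exp (s * U a) - 1 - s * U a))]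

lemma log_mgf_le
    (hp : ∀ a, 0 ≤ p a) (hp1 : ∑ a, p a = 1) (hU : ∑ a, p a * U a = 0)
    (hV : ∑ a, p a * U a ^ 2 = V) (hB : ∀ a, |U a| ≤ B) (hs : 0 ≤ s) (hsB : s * B ≤ 1) :
    Real.log (∑ a, p a * Real.exp (s * U a)) ≤ s ^ 2 * V / 2 + (s * B) ^ 3 := by
  have h1 := one_le_mgf (s := s) hp hp1 hU
  have h2 := Real.log_le_sub_one_of_pos (show 0 < ∑ a, p a * Real.exp (s * U a) by linarith)
  linarith [(abs_le.1 (abs_mgf_sub_le hp hp1 hU hV hB hs hsB)).2]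

lemma le_log_mgf
    (hp : ∀ a, 0 ≤ p a) (hp1 : ∑ a, p a = 1) (hU : ∑ a, p a * U a = 0)
    (hV : ∑ a, p a * U a ^ 2 = V) (hB : ∀ a, |U a| ≤ B) (hs : 0 ≤ s) (hsB : s * B ≤ 1) :
    s ^ 2 * V / 2 - 2 * (s * B) ^ 3 ≤ Real.log (∑ a, p a * Real.exp (s * U a)) := by
  have h1 := one_le_mgf (s := s) hp hp1 hU
  have h3 := mgf_le hp hp1 hU hB hs hsB
  have h4 := (abs_le.1 (abs_mgf_sub_le hp hp1 hU hV hB hs hsB)).1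
  set φ := ∑ a, p a * Real.exp (s * U a)
  have hφ : 0 < φ := by linarith
  have h2 := Real.one_sub_inv_le_log_of_pos hφ
  have h5 : (φ - 1) - (φ - 1) ^ 2 ≤ 1 - φ⁻¹ := by
    have : 1 - φ⁻¹ - ((φ - 1) - (φ - 1) ^ 2) = (φ - 1) ^ 3 / φ := by field_simp; ring
    have h : 0 ≤ (φ - 1) ^ 3 / φ := div_nonneg (pow_nonneg (by linarith) _) hφ.le
    linarith
  -- Nonnegativity of `B` is not assumed: it comes from a point of Ω, which exists because the
  -- weights sum to one.
  have hsB0 : 0 ≤ s * B := by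
    by_contra hneg
    push Not at hneg
    have hne : Nonempty Ω := by
      by_contra hne
      rw [not_nonempty_iff] at hne
      simp at hp1
    obtain ⟨a⟩ := hne
    nlinarith [abs_nonneg (U a), hB a]
  have h6 : (φ - 1) ^ 2 ≤ (s * B) ^ 3 := by
    calc (φ - 1) ^ 2 ≤ ((s * B) ^ 2) ^ 2 := pow_le_pow_left₀ (by linarith) (by linarith) 2
      _ = (s * B) ^ 4 := by ring
      _ ≤ (s * B) ^ 3 := pow_le_pow_of_le_one hsB0 hsB (by norm_num)
  linarith

/-- The tilted mean is the derivative of the log moment generating function, hence sV to first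
order. One half of the error is the Taylor remainder of the numerator, the other comes from
replacing the normalization φ by 1. -/
lemma exists_tilted_mean
    (hp : ∀ a, 0 ≤ p a) (hp1 : ∑ a, p a = 1) (hU : ∑ a, p a * U a = 0)
    (hV : ∑ a, p a * U a ^ 2 = V) (hB : ∀ a, |U a| ≤ B) (hs : 0 ≤ s) (hsB : s * B ≤ 1) :
    ∃ μ, ∑ a, p a * Real.exp (s * U a) * U a
      = (∑ a, p a * Real.exp (s * U a)) * μ ∧ |μ| ≤ B ∧ |μ - s * V| ≤ 2 * s ^ 2 * B ^ 3 := by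
  have h1 := one_le_mgf (s := s) hp hp1 hU
  have h3 := mgf_le hp hp1 hU hB hs hsB
  set φ := ∑ a, p a * Real.exp (s * U a) with hφdef
  have hφ : 0 < φ := by linarith
  set μ := (∑ a, p a * Real.exp (s * U a) * U a) / φ with hμdef
  have hμ : ∑ a, p a * Real.exp (s * U a) * U a = φ * μ := by rw [hμdef]; field_simp
  have hμB : |μ| ≤ B := by
    rw [hμdef, abs_div, abs_of_pos hφ, div_le_iff₀ hφ, hφdef, Finset.mul_sum]
    refine (Finset.abs_sum_le_sum_abs _ _).trans (Finset.sum_le_sum fun a _ => ?_)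
    have : 0 ≤ p a * Real.exp (s * U a) := mul_nonneg (hp a) (Real.exp_pos _).le
    rw [abs_mul, abs_of_nonneg this, mul_comm]
    exact mul_le_mul_of_nonneg_right (hB a) this
  refine ⟨μ, hμ, hμB, ?_⟩
  have hB0 : 0 ≤ B := (abs_nonneg _).trans hμB
  have h4 : |φ * μ - s * V| ≤ s ^ 2 * B ^ 3 := by
    have h : φ * μ - s * V = ∑ a, p a * (U a * (Real.exp (s * U a) - 1 - s * U a)) := by
      have : ∀ a, p a * (U a * (Real.exp (s * U a) - 1 - s * U a))
        = p a * Real.exp (s * U a) * U a - p a * U a - s * (p a * U a ^ 2) := fun a => by ring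
      simp_rw [this, Finset.sum_sub_distrib, ← Finset.mul_sum, hU, hV, hμ]
      ring
    rw [h]
    refine abs_sum_mul_le hp hp1 fun a => ?_
    have h1 := abs_mul_le hB hs a
    have h2 : |Real.exp (s * U a) - 1 - s * U a| ≤ (s * B) ^ 2 := by
      refine (Real.abs_exp_sub_one_sub_id_le (h1.trans hsB)).trans ?_
      rw [← sq_abs]
      exact pow_le_pow_left₀ (abs_nonneg _) h1 2
    rw [abs_mul]
    calc _ ≤ B * (s * B) ^ 2 := mul_le_mul (hB a) h2 (abs_nonneg _) hB0
      _ = _ := by ring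
  have h5 : |μ * (φ - 1)| ≤ B * (s * B) ^ 2 := by
    rw [abs_mul]
    refine mul_le_mul hμB ?_ (abs_nonneg _) hB0
    rw [abs_of_nonneg (by linarith)]
    linarith
  calc |μ - s * V| = |(φ * μ - s * V) - μ * (φ - 1)| := by ring_nf
    _ ≤ |φ * μ - s * V| + |μ * (φ - 1)| := abs_sub _ _
    _ ≤ _ := by nlinarith

end Moments

end FiniteIID

/-! ### Moderate deviations -/

namespace FiniteIID

variable {Ω : Type*} [Fintype Ω] {p U : Ω → ℝ} {V : ℝ} {ξ : ℕ → ℝ}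

lemma tendsto_mul_sq_atTop (hξ : Tendsto (fun n : ℕ => Real.sqrt (n : ℝ) * ξ n) atTop atTop) :
    Tendsto (fun n : ℕ => (n : ℝ) * ξ n ^ 2) atTop atTop := by
  have h := hξ.atTop_mul_atTop₀ hξ
  refine h.congr fun n => ?_
  have := Real.mul_self_sqrt (Nat.cast_nonneg (α := ℝ) n)
  linear_combination ξ n ^ 2 * this

lemma exists_abs_le (U : Ω → ℝ) : ∃ B, 0 < B ∧ ∀ a, |U a| ≤ B := by
  refine ⟨∑ a, |U a| + 1, by positivity, fun a => ?_⟩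
  have := Finset.single_le_sum (f := fun a => |U a|) (fun _ _ => abs_nonneg _)
    (Finset.mem_univ a)
  linarith

lemma eventually_mul_lt (hξ0 : Tendsto ξ atTop (𝓝 0)) (K : ℝ) {ε : ℝ} (hε : 0 < ε) :
    ∀ᶠ n in atTop, K * ξ n < ε := by
  have h := hξ0.const_mul K
  rw [mul_zero] at h
  exact h.eventually_lt_const hε

/-- Upper bound of the moderate deviations principle. -/
lemma eventually_upperTail_le (hp : ∀ a, 0 ≤ p a) (hp1 : ∑ a, p a = 1)
    (hU : ∑ a, p a * U a = 0) (hV : ∑ a, p a * U a ^ 2 = V) (hV0 : 0 < V)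
    (hξpos : ∀ᶠ n in atTop, 0 < ξ n) (hξ0 : Tendsto ξ atTop (𝓝 0))
    {a c : ℝ} (ha : 0 < a) (hc : c < a ^ 2 / (2 * V)) :
    ∀ᶠ n : ℕ in atTop,
      upperTail p U n (n * (a * ξ n)) ≤ Real.exp (-(n * ξ n ^ 2 * c)) := by
  obtain ⟨B, hB0, hB⟩ := exists_abs_le U
  filter_upwards [hξpos, eventually_mul_lt hξ0 (a / V * B) one_pos,
    eventually_mul_lt hξ0 ((a / V * B) ^ 3) (sub_pos.2 hc)] with n hx h1 h2
  set x := ξ n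
  -- The tilt s = aξ/V maximizes s·aξ - s²V/2, with value a²ξ²/(2V); the cubic remainder is of order
  -- ξ³ and disappears into the gap above `c`.
  have hs : 0 ≤ a / V * x := by positivity
  have hsB : a / V * x * B ≤ 1 := by nlinarith
  refine (upperTail_le_exp_mul hp n _ hs).trans ?_
  have hφ := one_le_mgf (s := a / V * x) hp hp1 hU
  have hlog := log_mgf_le hp hp1 hU hV hB hs hsB
  set φ := ∑ b, p b * Real.exp (a / V * x * U b)
  have hφ0 : 0 < φ := by linarith
  rw [← Real.exp_log hφ0, ← Real.exp_nat_mul, ← Real.exp_add]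
  refine Real.exp_le_exp.2 ?_
  have h3 := mul_le_mul_of_nonneg_left hlog (Nat.cast_nonneg (α := ℝ) n)
  have h4 : (n : ℝ) * ((a / V * x) ^ 2 * V / 2 + (a / V * x * B) ^ 3)
      - a / V * x * (n * (a * x)) = -(n * x ^ 2 * (a ^ 2 / (2 * V) - (a / V * B) ^ 3 * x)) := by
    field_simp
    ring
  have h5 : n * x ^ 2 * c ≤ n * x ^ 2 * (a ^ 2 / (2 * V) - (a / V * B) ^ 3 * x) :=
    mul_le_mul_of_nonneg_left (by linarith) (by positivity)
  linarith

/-- Lower bound of the moderate deviations principle. -/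
lemma eventually_le_upperTail (hp : ∀ a, 0 ≤ p a) (hp1 : ∑ a, p a = 1)
    (hU : ∑ a, p a * U a = 0) (hV : ∑ a, p a * U a ^ 2 = V) (hV0 : 0 < V)
    (hξpos : ∀ᶠ n in atTop, 0 < ξ n) (hξ0 : Tendsto ξ atTop (𝓝 0))
    (hξ : Tendsto (fun n : ℕ => Real.sqrt (n : ℝ) * ξ n) atTop atTop)
    {a c : ℝ} (ha : 0 < a) (hc : a ^ 2 / (2 * V) < c) :
    ∀ᶠ n : ℕ in atTop,
      Real.exp (-(n * ξ n ^ 2 * c)) ≤ upperTail p U n (n * (a * ξ n)) := by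
  obtain ⟨B, hB0, hB⟩ := exists_abs_le U
  -- The tilt aims at mean (a+δ)ξ. An error δξ/2 in the mean and a window of half-width δξ/2 keep
  -- the sample average between aξ and (a+2δ)ξ; the displayed expression is the resulting cost,
  -- which tends to a²/(2V) as δ → 0.
  obtain ⟨δ, hδ0, hδ⟩ : ∃ δ : ℝ, 0 < δ ∧
      (a + δ) * (a + 2 * δ) / V - (a + δ) ^ 2 / (2 * V) < c := by
    have hcont : Tendsto (fun δ : ℝ => (a + δ) * (a + 2 * δ) / V - (a + δ) ^ 2 / (2 * V))
        (𝓝[>] 0) (𝓝 (a ^ 2 / (2 * V))) := by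
      have : Continuous (fun δ : ℝ => (a + δ) * (a + 2 * δ) / V - (a + δ) ^ 2 / (2 * V)) := by
        fun_prop
      have h := (this.tendsto 0).mono_left (nhdsWithin_le_nhds (s := Set.Ioi 0))
      convert h using 2
      field_simp
      ring
    obtain ⟨δ, h1, h2⟩ := ((hcont.eventually_lt_const hc).and self_mem_nhdsWithin).exists
    exact ⟨δ, h2, h1⟩
  set c₀ := (a + δ) * (a + 2 * δ) / V - (a + δ) ^ 2 / (2 * V) with hc₀
  set k := (a + δ) / V with hk
  have hk0 : 0 < k := by positivity
  have hkV : k * V = a + δ := by rw [hk]; field_simp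
  have hb := tendsto_mul_sq_atTop hξ
  have hgap : 0 < (c - c₀) / 2 := by linarith
  filter_upwards [hξpos, eventually_mul_lt hξ0 (k * B) one_pos,
    eventually_mul_lt hξ0 (2 * (k * B) ^ 3) hgap,
    eventually_mul_lt hξ0 (2 * k ^ 2 * B ^ 3) (half_pos hδ0),
    -- Here nξ² → ∞ enters: it makes the Chebyshev loss 16B²/(δ²nξ²) at most 1/2. The next condition
    -- absorbs the remaining factor 1/2 into the exponent.
    hb.eventually_ge_atTop (32 * B ^ 2 / δ ^ 2),
    hb.eventually_ge_atTop (Real.log 2 / ((c - c₀) / 2)),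
    hb.eventually_gt_atTop 0] with n hx h1 h2 h3 h4 h5 hb0
  set x := ξ n
  have hn : (0 : ℝ) < n := by
    rcases (Nat.cast_nonneg (α := ℝ) n).eq_or_lt with h | h
    · rw [← h] at hb0; simp at hb0
    · exact h
  have hs : 0 ≤ k * x := by positivity
  have hsB : k * x * B ≤ 1 := by nlinarith
  have hφ := one_le_mgf (s := k * x) hp hp1 hU
  have hlog := le_log_mgf hp hp1 hU hV hB hs hsB
  obtain ⟨μ, hμ, hμB, hμV⟩ := exists_tilted_mean hp hp1 hU hV hB hs hsB
  set φ := ∑ b, p b * Real.exp (k * x * U b) with hφdef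
  have hφ0 : 0 < φ := by linarith
  have hh : 0 < n * (δ * x / 2) := by positivity
  have hv : ∀ b, (U b - μ) ^ 2 ≤ 4 * B ^ 2 := by
    intro b
    have h := abs_sub (U b) μ
    rw [← sq_abs]
    calc |U b - μ| ^ 2 ≤ (2 * B) ^ 2 :=
          pow_le_pow_left₀ (abs_nonneg _) (by linarith [hB b]) 2
      _ = 4 * B ^ 2 := by ring
  have htilt := le_upperTail_of_tilt hp hs hφdef.symm hφ0 hμ hv hh n
  have hμx : |μ - (a + δ) * x| ≤ δ * x / 2 := by
    have e : k * x * V = (a + δ) * x := by rw [← hkV]; ring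
    rw [e] at hμV
    refine hμV.trans ?_
    have := mul_le_mul_of_nonneg_right h3.le hx.le
    linarith
  rw [abs_le] at hμx
  have hmono : upperTail p U n (n * μ - n * (δ * x / 2)) ≤ upperTail p U n (n * (a * x)) := by
    refine upperTail_anti hp n ?_
    have := mul_le_mul_of_nonneg_left (show a * x ≤ μ - δ * x / 2 by linarith) hn.le
    linarith
  refine le_trans ?_ (htilt.trans hmono)
  have hcheb : (1 : ℝ) / 2 ≤ 1 - n * (4 * B ^ 2) / (n * (δ * x / 2)) ^ 2 := by
    have e : n * (4 * B ^ 2) / (n * (δ * x / 2)) ^ 2 = 16 * B ^ 2 / δ ^ 2 / (n * x ^ 2) := by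
      field_simp
      ring
    have : 16 * B ^ 2 / δ ^ 2 / (n * x ^ 2) ≤ 1 / 2 := by
      rw [div_le_iff₀ hb0]
      have e2 : 32 * B ^ 2 / δ ^ 2 = 2 * (16 * B ^ 2 / δ ^ 2) := by ring
      rw [e2] at h4
      linarith
    rw [e]
    linarith
  have hhalf : Real.exp (-(n * x ^ 2 * ((c - c₀) / 2))) ≤ 1 / 2 := by
    have h6 : Real.log 2 ≤ n * x ^ 2 * ((c - c₀) / 2) := (div_le_iff₀ hgap).1 h5
    calc _ ≤ Real.exp (-Real.log 2) := Real.exp_le_exp.2 (by linarith)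
      _ = 1 / 2 := by rw [Real.exp_neg, Real.exp_log two_pos, one_div]
  have hmain : Real.exp (-(n * x ^ 2 * ((c + c₀) / 2)))
      ≤ φ ^ n * Real.exp (-(k * x * (n * μ + n * (δ * x / 2)))) := by
    rw [← Real.exp_log hφ0, ← Real.exp_nat_mul, ← Real.exp_add]
    refine Real.exp_le_exp.2 ?_
    have h7 := mul_le_mul_of_nonneg_left hlog hn.le
    have h8 : k * x * (n * μ + n * (δ * x / 2)) ≤ k * x * (n * ((a + 2 * δ) * x)) := by
      refine mul_le_mul_of_nonneg_left ?_ hs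
      have := mul_le_mul_of_nonneg_left (show μ + δ * x / 2 ≤ (a + 2 * δ) * x by linarith) hn.le
      linarith
    have h9 : (n : ℝ) * ((k * x) ^ 2 * V / 2 - 2 * (k * x * B) ^ 3)
        - k * x * (n * ((a + 2 * δ) * x)) = -(n * x ^ 2 * (c₀ + 2 * (k * B) ^ 3 * x)) := by
      have e : c₀ = k * (a + 2 * δ) - k ^ 2 * V / 2 := by
        rw [hc₀, hk]
        field_simp
      rw [e]
      ring
    have h10 : n * x ^ 2 * (c₀ + 2 * (k * B) ^ 3 * x) ≤ n * x ^ 2 * ((c + c₀) / 2) :=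
      mul_le_mul_of_nonneg_left (by linarith) hb0.le
    linarith
  calc Real.exp (-(n * x ^ 2 * c))
      = Real.exp (-(n * x ^ 2 * ((c + c₀) / 2))) * Real.exp (-(n * x ^ 2 * ((c - c₀) / 2))) := by
        rw [← Real.exp_add]
        congr 1
        ring
    _ ≤ _ := by
        refine mul_le_mul hmain (hhalf.trans hcheb) (Real.exp_pos _).le (by positivity)

end FiniteIID

/-! ### Reduction to the information density -/

namespace BioModel

open FiniteIID Identification

variable {X Y Z : Type*} [Fintype X] [Fintype Y] [Fintype Z] (S : BioModel X Y Z)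

lemma pYZ_nonneg (y : Y) (z : Z) : 0 ≤ S.pYZ y z :=
  Finset.sum_nonneg fun x _ =>
    mul_nonneg (mul_nonneg (S.pX_mem.1 x) ((S.chY_mem x).1 y)) ((S.chZ_mem x).1 z)

lemma pY_nonneg (y : Y) : 0 ≤ S.pY y :=
  Finset.sum_nonneg fun x _ => mul_nonneg (S.pX_mem.1 x) ((S.chY_mem x).1 y)

lemma pZ_nonneg (z : Z) : 0 ≤ S.pZ z :=
  Finset.sum_nonneg fun x _ => mul_nonneg (S.pX_mem.1 x) ((S.chZ_mem x).1 z)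

lemma sum_pYZ_left (z : Z) : ∑ y, S.pYZ y z = S.pZ z := by
  unfold pYZ pZ
  rw [Finset.sum_comm]
  refine Finset.sum_congr rfl fun x _ => ?_
  rw [← Finset.sum_mul, ← Finset.mul_sum, (S.chY_mem x).2, mul_one]

lemma sum_pYZ_right (y : Y) : ∑ z, S.pYZ y z = S.pY y := by
  unfold pYZ pY
  rw [Finset.sum_comm]
  refine Finset.sum_congr rfl fun x _ => ?_
  rw [← Finset.mul_sum, (S.chZ_mem x).2, mul_one]

lemma sum_pY : ∑ y, S.pY y = 1 := by
  unfold pY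
  rw [Finset.sum_comm]
  simp_rw [← Finset.mul_sum, fun x => (S.chY_mem x).2, mul_one]
  exact S.pX_mem.2

lemma sum_pZ : ∑ z, S.pZ z = 1 := by
  unfold pZ
  rw [Finset.sum_comm]
  simp_rw [← Finset.mul_sum, fun x => (S.chZ_mem x).2, mul_one]
  exact S.pX_mem.2

lemma pY_pos {y : Y} {z : Z} (h : 0 < S.pYZ y z) : 0 < S.pY y := by
  rw [← S.sum_pYZ_right y]
  exact h.trans_le (Finset.single_le_sum (f := fun z => S.pYZ y z)
    (fun z _ => S.pYZ_nonneg y z) (Finset.mem_univ z))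

lemma pZ_pos {y : Y} {z : Z} (h : 0 < S.pYZ y z) : 0 < S.pZ z := by
  rw [← S.sum_pYZ_left z]
  exact h.trans_le (Finset.single_le_sum (f := fun y => S.pYZ y z)
    (fun y _ => S.pYZ_nonneg y z) (Finset.mem_univ y))

lemma exp_infoDensity {y : Y} {z : Z} (h : 0 < S.pYZ y z) :
    Real.exp (S.infoDensity y z) = S.pYZ y z / (S.pY y * S.pZ z) := by
  have h1 := S.pY_pos h
  have h2 := S.pZ_pos h
  rw [infoDensity, chZY, div_div, Real.exp_log (by positivity)]

/-- `P_{YZ}` as a weight function on pairs. -/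
def pairProb (a : Y × Z) : ℝ := S.pYZ a.1 a.2

/-- The centered information density, as a function on pairs. -/
noncomputable def centeredDensity (a : Y × Z) : ℝ := S.infoDensity a.1 a.2 - S.infoMean

lemma pairProb_nonneg (a : Y × Z) : 0 ≤ S.pairProb a := S.pYZ_nonneg _ _

lemma sum_pairProb : ∑ a, S.pairProb a = 1 := by
  rw [Fintype.sum_prod_type, ← S.sum_pY]
  exact Finset.sum_congr rfl fun y _ => S.sum_pYZ_right y

lemma sum_pairProb_mul_centeredDensity : ∑ a, S.pairProb a * S.centeredDensity a = 0 := by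
  unfold centeredDensity
  simp_rw [mul_sub, Finset.sum_sub_distrib, ← Finset.sum_mul, S.sum_pairProb, one_mul,
    Fintype.sum_prod_type]
  exact sub_self _

lemma sum_pairProb_mul_centeredDensity_sq :
    ∑ a, S.pairProb a * S.centeredDensity a ^ 2 = S.infoVariance := by
  rw [Fintype.sum_prod_type]
  rfl

/-- Mutual information is nonnegative because exp(-i) ≥ 1 - i. If it were zero, equality would hold
termwise, so i would vanish on the support and V would be zero. -/
lemma infoMean_pos (hV : 0 < S.infoVariance) : 0 < S.infoMean := by
  have key : ∀ a : Y × Z, S.pairProb a - S.pY a.1 * S.pZ a.2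
      ≤ S.pairProb a * S.infoDensity a.1 a.2 ∧
      (S.pairProb a - S.pY a.1 * S.pZ a.2 = S.pairProb a * S.infoDensity a.1 a.2 →
        S.pairProb a * S.infoDensity a.1 a.2 ^ 2 = 0) := by
    rintro ⟨y, z⟩
    change S.pYZ y z - S.pY y * S.pZ z ≤ S.pYZ y z * S.infoDensity y z ∧
      (S.pYZ y z - S.pY y * S.pZ z = S.pYZ y z * S.infoDensity y z →
        S.pYZ y z * S.infoDensity y z ^ 2 = 0)
    rcases (S.pYZ_nonneg y z).eq_or_lt with h | h
    · have := mul_nonneg (S.pY_nonneg y) (S.pZ_nonneg z)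
      rw [← h]
      simp only [zero_mul, zero_sub, implies_true, and_true]
      linarith
    · have h1 := S.pY_pos h
      have h2 := S.pZ_pos h
      have e : S.pY y * S.pZ z = S.pYZ y z * Real.exp (-S.infoDensity y z) := by
        rw [Real.exp_neg, S.exp_infoDensity h]
        field_simp
      rw [e]
      constructor
      · have := mul_le_mul_of_nonneg_left (Real.add_one_le_exp (-S.infoDensity y z)) h.le
        linarith
      · intro heq
        by_cases hi : S.infoDensity y z = 0
        · simp [hi]
        · have := mul_lt_mul_of_pos_left (Real.add_one_lt_exp (neg_ne_zero.2 hi)) h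
          linarith
  have hmean : ∑ a : Y × Z, S.pairProb a * S.infoDensity a.1 a.2 = S.infoMean := by
    rw [Fintype.sum_prod_type]
    rfl
  have hsum : ∑ a : Y × Z, (S.pairProb a - S.pY a.1 * S.pZ a.2) = 0 := by
    rw [Finset.sum_sub_distrib, S.sum_pairProb, Fintype.sum_prod_type]
    simp_rw [← Finset.mul_sum, S.sum_pZ, mul_one]
    rw [S.sum_pY, sub_self]
  have hle : 0 ≤ S.infoMean := by
    rw [← hmean, ← hsum]
    exact Finset.sum_le_sum fun a _ => (key a).1
  refine hle.lt_of_ne fun h0 => hV.ne' ?_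
  have heq : ∀ a ∈ Finset.univ, S.pairProb a - S.pY a.1 * S.pZ a.2
      = S.pairProb a * S.infoDensity a.1 a.2 :=
    (Finset.sum_eq_sum_iff_of_le fun a _ => (key a).1).1 (by rw [hsum, hmean, h0])
  rw [← S.sum_pairProb_mul_centeredDensity_sq]
  refine Finset.sum_eq_zero fun a ha => ?_
  rw [centeredDensity, ← h0, sub_zero]
  exact (key a).2 (heq a ha)

/-- The joint probability with the feature vectors summed out. -/
lemma sum_jointProb {n M : ℕ} (y : Fin M → Fin n → Y) (w : Fin M) (z : Fin n → Z) :
    ∑ x : Fin M → Fin n → X, S.jointProb x y w z = (1 / (M : ℝ)) *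
      ((∏ i, S.pYZ (y w i) (z i)) * ∏ m ∈ Finset.univ.erase w, ∏ i, S.pY (y m i)) := by
  have h : ∀ x : Fin M → Fin n → X, S.jointProb x y w z = (1 / (M : ℝ)) *
      ∏ m, ∏ i, (S.pX (x m i) * S.chY (x m i) (y m i) *
        if m = w then S.chZ (x m i) (z i) else 1) := by
    intro x
    have : ∏ m, ∏ i, (if m = w then S.chZ (x m i) (z i) else 1) = ∏ i, S.chZ (x w i) (z i) := by
      rw [Fintype.prod_eq_single w]
      · simp
      · intro m hm
        simp [hm]
    simp_rw [Finset.prod_mul_distrib]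
    rw [this, jointProb]
    simp_rw [Finset.prod_mul_distrib]
    ring
  simp_rw [h]
  rw [← Finset.mul_sum, ← Fintype.prod_sum (fun m (f : Fin n → X) => ∏ i, (S.pX (f i) *
    S.chY (f i) (y m i) * if m = w then S.chZ (f i) (z i) else 1))]
  have h2 : ∀ m, ∑ f : Fin n → X, ∏ i, (S.pX (f i) *
      S.chY (f i) (y m i) * if m = w then S.chZ (f i) (z i) else 1)
      = ∏ i, ∑ a, (S.pX a * S.chY a (y m i) * if m = w then S.chZ a (z i) else 1) := fun m =>
    (Fintype.prod_sum (fun i a => S.pX a * S.chY a (y m i) *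
      if m = w then S.chZ a (z i) else 1)).symm
  simp_rw [h2]
  rw [← Finset.mul_prod_erase Finset.univ _ (Finset.mem_univ w)]
  congr 2
  · simp [pYZ]
  · refine Finset.prod_congr rfl fun m hm => ?_
    simp [Finset.ne_of_mem_erase hm, pY]

/-- This makes the block problem an instance of the one-shot problem with alphabets Y^n and Z^n. -/
lemma probCorrect_eq_successProb {n M : ℕ} (g : BioDecoder Y Z n M) :
    S.probCorrect g = successProb (fun (y : Fin n → Y) (z : Fin n → Z) => ∏ i, S.pYZ (y i) (z i))
      (fun y => ∏ i, S.pY (y i)) g := by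
  unfold probCorrect successProb
  rw [Finset.sum_comm]
  refine Finset.sum_congr rfl fun y _ => ?_
  rw [Finset.sum_comm]
  refine Finset.sum_congr rfl fun w _ => ?_
  rw [Finset.sum_comm]
  refine Finset.sum_congr rfl fun z _ => ?_
  rw [← S.sum_jointProb]
  split_ifs
  · rfl
  · simp

lemma sum_prod_pY (n : ℕ) : ∑ y : Fin n → Y, ∏ i, S.pY (y i) = 1 := by
  rw [sum_prod_eq_pow, S.sum_pY, one_pow]

lemma sum_prod_pZ (n : ℕ) : ∑ z : Fin n → Z, ∏ i, S.pZ (z i) = 1 := by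
  rw [sum_prod_eq_pow, S.sum_pZ, one_pow]

lemma sum_prod_pYZ {n : ℕ} (z : Fin n → Z) :
    ∑ y : Fin n → Y, ∏ i, S.pYZ (y i) (z i) = ∏ i, S.pZ (z i) := by
  rw [← Fintype.prod_sum (fun i a => S.pYZ a (z i))]
  exact Finset.prod_congr rfl fun i _ => S.sum_pYZ_left (z i)

lemma probCorrect_add_probError {n M : ℕ} (hM : 1 ≤ M) (g : BioDecoder Y Z n M) :
    S.probCorrect g + S.probError g = 1 := by
  have hM0 : (M : ℝ) ≠ 0 := by exact_mod_cast (by omega : M ≠ 0)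
  unfold probCorrect probError
  simp_rw [← Finset.sum_add_distrib]
  have h : ∀ (x : Fin M → Fin n → X) (y : Fin M → Fin n → Y) (w : Fin M) (z : Fin n → Z),
      ((if g y z = w then S.jointProb x y w z else 0) +
        if g y z ≠ w then S.jointProb x y w z else 0) = S.jointProb x y w z := by
    intro x y w z
    by_cases hg : g y z = w <;> simp [hg]
  simp_rw [h]
  rw [Finset.sum_comm]
  have h2 : ∀ y : Fin M → Fin n → Y, ∑ x : Fin M → Fin n → X, ∑ w, ∑ z, S.jointProb x y w z
      = ∑ w, ∑ z : Fin n → Z, (1 / (M : ℝ)) *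
      ((∏ i, S.pYZ (y w i) (z i)) * ∏ m ∈ Finset.univ.erase w, ∏ i, S.pY (y m i)) := by
    intro y
    rw [Finset.sum_comm]
    refine Finset.sum_congr rfl fun w _ => ?_
    rw [Finset.sum_comm]
    exact Finset.sum_congr rfl fun z _ => S.sum_jointProb y w z
  simp_rw [h2]
  rw [Finset.sum_comm]
  have h3 : ∀ w : Fin M, ∑ y : Fin M → Fin n → Y, ∑ z : Fin n → Z, (1 / (M : ℝ)) *
      ((∏ i, S.pYZ (y w i) (z i)) * ∏ m ∈ Finset.univ.erase w, ∏ i, S.pY (y m i))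
      = 1 / (M : ℝ) := by
    intro w
    rw [Finset.sum_comm]
    have : ∀ z : Fin n → Z, ∑ y : Fin M → Fin n → Y, (1 / (M : ℝ)) *
      ((∏ i, S.pYZ (y w i) (z i)) * ∏ m ∈ Finset.univ.erase w, ∏ i, S.pY (y m i))
      = 1 / (M : ℝ) * ∏ i, S.pZ (z i) := by
      intro z
      rw [← Finset.mul_sum, sum_mul_prod_erase (fun f : Fin n → Y => ∏ i, S.pY (f i))
        (S.sum_prod_pY n) (fun f => ∏ i, S.pYZ (f i) (z i)) w, S.sum_prod_pYZ]
    simp_rw [this]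
    rw [← Finset.mul_sum, S.sum_prod_pZ, mul_one]
  simp_rw [h3]
  simp [hM0]

/-- The probability that the information density of `n` samples exceeds `t`. -/
noncomputable def densityTail (n : ℕ) (t : ℝ) : ℝ :=
  ∑ ω : Fin n → Y × Z,
    if t < ∑ i, S.infoDensity (ω i).1 (ω i).2 then ∏ i, S.pairProb (ω i) else 0

/-- On the support of P_YZ^n the likelihood ratio is the exponential of the summed densities; off it
both sides vanish, so the conventions for log and division do no harm. -/
lemma sum_above (n : ℕ) (t : ℝ) :
    ∑ z : Fin n → Z, ∑ y : Fin n → Y, above (fun y z => ∏ i, S.pYZ (y i) (z i))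
      (fun y => ∏ i, S.pY (y i)) (fun z => ∏ i, S.pZ (z i)) t y z = S.densityTail n t := by
  rw [Finset.sum_comm, ← Fintype.sum_prod_type', densityTail,
    ← (Equiv.arrowProdEquivProdArrow (Fin n) (fun _ => Y) (fun _ => Z)).sum_comp]
  refine Finset.sum_congr rfl fun ω _ => ?_
  change (if Real.exp t * ((∏ i, S.pY (ω i).1) * ∏ i, S.pZ (ω i).2) < ∏ i, S.pairProb (ω i)
    then ∏ i, S.pairProb (ω i) else 0) = _
  rcases (Finset.prod_nonneg fun i (_ : i ∈ Finset.univ) =>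
    S.pairProb_nonneg (ω i)).eq_or_lt with h | h
  · simp [← h]
  · have hpos : ∀ i, 0 < S.pYZ (ω i).1 (ω i).2 := fun i =>
      (S.pairProb_nonneg (ω i)).lt_of_ne' (Finset.prod_ne_zero_iff.1 h.ne' i (Finset.mem_univ i))
    have e : ∏ i, S.pairProb (ω i) = Real.exp (∑ i, S.infoDensity (ω i).1 (ω i).2) *
        ((∏ i, S.pY (ω i).1) * ∏ i, S.pZ (ω i).2) := by
      rw [Real.exp_sum, ← Finset.prod_mul_distrib, ← Finset.prod_mul_distrib]
      refine Finset.prod_congr rfl fun i _ => ?_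
      have h1 := S.pY_pos (hpos i)
      have h2 := S.pZ_pos (hpos i)
      rw [S.exp_infoDensity (hpos i), pairProb]
      field_simp
    have hpp : 0 < (∏ i, S.pY (ω i).1) * ∏ i, S.pZ (ω i).2 :=
      mul_pos (Finset.prod_pos fun i _ => S.pY_pos (hpos i))
        (Finset.prod_pos fun i _ => S.pZ_pos (hpos i))
    have : Real.exp t * ((∏ i, S.pY (ω i).1) * ∏ i, S.pZ (ω i).2) < ∏ i, S.pairProb (ω i) ↔
        t < ∑ i, S.infoDensity (ω i).1 (ω i).2 := by
      rw [e, mul_lt_mul_iff_left₀ hpp, Real.exp_lt_exp]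
    simp only [this]

lemma sum_centeredDensity {n : ℕ} (ω : Fin n → Y × Z) :
    ∑ i, S.centeredDensity (ω i) = ∑ i, S.infoDensity (ω i).1 (ω i).2 - n * S.infoMean := by
  simp [centeredDensity, Finset.sum_sub_distrib]

lemma prod_pairProb_nonneg {n : ℕ} (ω : Fin n → Y × Z) : 0 ≤ ∏ i, S.pairProb (ω i) :=
  Finset.prod_nonneg fun i _ => S.pairProb_nonneg (ω i)

lemma densityTail_le_upperTail (n : ℕ) (t : ℝ) :
    S.densityTail n t ≤ upperTail S.pairProb S.centeredDensity n (t - n * S.infoMean) := by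
  refine Finset.sum_le_sum fun ω _ => ?_
  have h0 := S.prod_pairProb_nonneg ω
  rw [S.sum_centeredDensity]
  split_ifs with h1 h2 h2
  · exact le_rfl
  · exact absurd (by linarith) h2
  · exact h0
  · exact le_rfl

lemma upperTail_le_densityTail (n : ℕ) {t t' : ℝ} (ht : t < t') :
    upperTail S.pairProb S.centeredDensity n (t' - n * S.infoMean) ≤ S.densityTail n t := by
  refine Finset.sum_le_sum fun ω _ => ?_
  have h0 := S.prod_pairProb_nonneg ω
  rw [S.sum_centeredDensity]
  split_ifs with h1 h2 h2
  · exact le_rfl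
  · exact absurd (by linarith) h2
  · exact h0
  · exact le_rfl

lemma densityTail_nonneg (n : ℕ) (t : ℝ) : 0 ≤ S.densityTail n t := by
  refine Finset.sum_nonneg fun ω _ => ?_
  have h0 := S.prod_pairProb_nonneg ω
  split_ifs
  · exact h0
  · exact le_rfl

lemma one_sub_densityTail (n : ℕ) (t : ℝ) : 1 - S.densityTail n t =
    upperTail S.pairProb (fun a => -S.centeredDensity a) n (n * S.infoMean - t) := by
  have h1 : ∑ ω : Fin n → Y × Z, ∏ i, S.pairProb (ω i) = 1 := by
    rw [sum_prod_eq_pow, S.sum_pairProb, one_pow]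
  rw [← h1, densityTail, ← Finset.sum_sub_distrib, upperTail]
  refine Finset.sum_congr rfl fun ω _ => ?_
  rw [Finset.sum_neg_distrib, S.sum_centeredDensity]
  by_cases h : t < ∑ i, S.infoDensity (ω i).1 (ω i).2
  · rw [if_pos h, if_neg (by linarith), sub_self]
  · rw [if_neg h, if_pos (by linarith [not_lt.1 h]), sub_zero]

lemma probCorrect_le {n M : ℕ} (hM : 1 ≤ M) (g : BioDecoder Y Z n M) (t : ℝ) :
    S.probCorrect g ≤ S.densityTail n t + Real.exp t / M := by
  rw [S.probCorrect_eq_successProb, ← S.sum_above]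
  exact successProb_le (fun y => Finset.prod_nonneg fun i _ => S.pY_nonneg _)
    (fun y => Finset.prod_nonneg fun i _ => S.pZ_nonneg _) (S.sum_prod_pY n) (S.sum_prod_pZ n)
    (fun y z => Finset.prod_nonneg fun i _ => S.pYZ_nonneg _ _) t hM g

lemma exists_le_probCorrect (n : ℕ) {M : ℕ} (hM : 1 ≤ M) (t : ℝ) :
    ∃ g : BioDecoder Y Z n M,
      S.densityTail n t * (1 - M * Real.exp (-t)) ≤ S.probCorrect g := by
  obtain ⟨g, hg⟩ := exists_le_successProb
    (fun y : Fin n → Y => Finset.prod_nonneg fun i _ => S.pY_nonneg (y i)) (S.sum_prod_pY n)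
    (fun z : Fin n → Z => Finset.prod_nonneg fun i _ => S.pZ_nonneg (z i))
    (fun y z => Finset.prod_nonneg fun i _ => S.pYZ_nonneg (y i) (z i)) S.sum_prod_pYZ t hM
  refine ⟨g, ?_⟩
  rw [S.probCorrect_eq_successProb, ← S.sum_above]
  exact hg

lemma probError_nonneg {n M : ℕ} (g : BioDecoder Y Z n M) : 0 ≤ S.probError g := by
  refine Finset.sum_nonneg fun x _ => Finset.sum_nonneg fun y _ => Finset.sum_nonneg fun w _ =>
    Finset.sum_nonneg fun z _ => ?_
  split_ifs
  · refine mul_nonneg (Finset.prod_nonneg fun m _ => mul_nonneg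
      (Finset.prod_nonneg fun i _ => S.pX_mem.1 _)
      (Finset.prod_nonneg fun i _ => (S.chY_mem _).1 _)) (mul_nonneg (by positivity)
      (Finset.prod_nonneg fun i _ => (S.chZ_mem _).1 _))
  · exact le_rfl

lemma probCorrect_le_one {n M : ℕ} (hM : 1 ≤ M) (g : BioDecoder Y Z n M) :
    S.probCorrect g ≤ 1 := by
  linarith [S.probCorrect_add_probError hM g, S.probError_nonneg g]

lemma exists_probError_le (n : ℕ) {M : ℕ} (hM : 1 ≤ M) (t : ℝ) :
    ∃ g : BioDecoder Y Z n M, S.probError g ≤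
      upperTail S.pairProb (fun a => -S.centeredDensity a) n (n * S.infoMean - t)
        + M * Real.exp (-t) := by
  obtain ⟨g, hg⟩ := S.exists_le_probCorrect n hM t
  refine ⟨g, ?_⟩
  rw [← S.one_sub_densityTail]
  have h1 : S.densityTail n t ≤ 1 := by
    rw [← sub_nonneg, S.one_sub_densityTail]
    refine Finset.sum_nonneg fun ω _ => ?_
    have h0 := S.prod_pairProb_nonneg ω
    split_ifs
    · exact h0
    · exact le_rfl
  have h2 := S.probCorrect_add_probError hM g
  have h3 : 0 ≤ M * Real.exp (-t) := by positivity
  nlinarith [S.densityTail_nonneg n t]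

lemma bddAbove_probCorrect (n : ℕ) (R : ℝ) : BddAbove {p : ℝ | ∃ M : ℕ, 1 ≤ M ∧
    (n : ℝ) * R ≤ Real.log (M : ℝ) ∧ ∃ g : BioDecoder Y Z n M, p = S.probCorrect g} := by
  refine ⟨1, ?_⟩
  rintro _ ⟨M, hM, -, g, rfl⟩
  exact S.probCorrect_le_one hM g

lemma probCorrect_le_maxProbCorrect {n M : ℕ} {R : ℝ} (hM : 1 ≤ M)
    (hR : (n : ℝ) * R ≤ Real.log M) (g : BioDecoder Y Z n M) :
    S.probCorrect g ≤ S.maxProbCorrect n R :=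
  le_csSup (S.bddAbove_probCorrect n R) ⟨M, hM, hR, g, rfl⟩

/-- The ceiling is the least admissible number of items. Rounding costs a factor of at most 2 only
when exp u ≥ 1, hence the condition on `u`. -/
lemma natCeil_exp (u : ℝ) : 1 ≤ ⌈Real.exp u⌉₊ ∧ u ≤ Real.log (⌈Real.exp u⌉₊ : ℝ) ∧
    (0 ≤ u → (⌈Real.exp u⌉₊ : ℝ) ≤ 2 * Real.exp u) := by
  have h1 : 1 ≤ ⌈Real.exp u⌉₊ := Nat.one_le_ceil_iff.2 (Real.exp_pos u)
  refine ⟨h1, ?_, fun hu => ?_⟩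
  · rw [Real.le_log_iff_exp_le (by exact_mod_cast h1)]
    exact Nat.le_ceil _
  · have := (Nat.ceil_lt_add_one (Real.exp_pos u).le).le
    linarith [Real.one_le_exp hu]

/-- Converse bound on `P_c^*`. -/
lemma maxProbCorrect_le (n : ℕ) (R t : ℝ) :
    S.maxProbCorrect n R ≤ S.densityTail n t + Real.exp (t - n * R) := by
  refine csSup_le ?_ ?_
  · obtain ⟨h1, h2, -⟩ := natCeil_exp (n * R)
    exact ⟨_, _, h1, h2, fun _ _ => ⟨0, h1⟩, rfl⟩
  · rintro _ ⟨M, hM, hR, g, rfl⟩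
    refine (S.probCorrect_le hM g t).trans ?_
    have hM0 : (0 : ℝ) < M := by exact_mod_cast hM
    rw [Real.exp_sub]
    gcongr
    exact (Real.le_log_iff_exp_le hM0).1 hR

end BioModel

/-! ### The capacity equals the mutual information -/

namespace BioModel

open FiniteIID Identification

variable {X Y Z : Type*} [Fintype X] [Fintype Y] [Fintype Z] (S : BioModel X Y Z)

lemma sum_pairProb_mul_neg_centeredDensity :
    ∑ a, S.pairProb a * -S.centeredDensity a = 0 := by
  simp [S.sum_pairProb_mul_centeredDensity]

lemma sum_pairProb_mul_neg_centeredDensity_sq :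
    ∑ a, S.pairProb a * (-S.centeredDensity a) ^ 2 = S.infoVariance := by
  simp [S.sum_pairProb_mul_centeredDensity_sq]

lemma tendsto_chebyshev_add_exp (V : ℝ) {η : ℝ} (hη : 0 < η) :
    Tendsto (fun n : ℕ => n * V / (n * η) ^ 2 + 2 * Real.exp (-(n * η))) atTop (𝓝 0) := by
  have hn : Tendsto (fun n : ℕ => (n : ℝ)) atTop atTop := tendsto_natCast_atTop_atTop
  have h1 : Tendsto (fun n : ℕ => n * V / (n * η) ^ 2) atTop (𝓝 0) := by
    have h := hn.const_div_atTop (V / η ^ 2)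
    refine h.congr' ?_
    filter_upwards [eventually_gt_atTop 0] with n hn0
    have : (n : ℝ) ≠ 0 := by exact_mod_cast hn0.ne'
    field_simp
  have h2 : Tendsto (fun n : ℕ => 2 * Real.exp (-(n * η))) atTop (𝓝 (2 * 0)) :=
    (Real.tendsto_exp_neg_atTop_nhds_zero.comp (hn.atTop_mul_const hη)).const_mul 2
  simpa using h1.add h2

lemma isAchievable_of_lt {ε R : ℝ} (hε : 0 < ε) (hR0 : 0 ≤ R) (hR : R < S.infoMean) :
    -- The threshold lies halfway between R and the mean, so both the tail and the false-alarm term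
    -- see a gap η.
    S.IsAchievable ε R := by
  set η := (S.infoMean - R) / 2 with hη
  have hη0 : 0 < η := by rw [hη]; linarith
  have hM : ∀ n : ℕ, 1 ≤ ⌈Real.exp (n * R)⌉₊ := fun n => (natCeil_exp _).1
  choose g hg using fun n : ℕ => S.exists_probError_le n (hM n) (n * (R + η))
  refine ⟨fun n => ⌈Real.exp (n * R)⌉₊, g, hM, ?_, ?_⟩
  · refine le_liminf_of_le (h := ?_)
    filter_upwards [eventually_gt_atTop 0] with n hn
    have hn' : (0 : ℝ) < n := by exact_mod_cast hn
    rw [EReal.coe_le_coe_iff, le_div_iff₀ hn', mul_comm]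
    exact (natCeil_exp _).2.1
  · refine limsup_le_of_le (h := ?_)
    filter_upwards [eventually_gt_atTop 0,
      (tendsto_chebyshev_add_exp S.infoVariance hη0).eventually_lt_const hε] with n hn hlt
    have hn' : (0 : ℝ) < n := by exact_mod_cast hn
    rw [EReal.coe_le_coe_iff]
    refine (hg n).trans (le_trans (add_le_add ?_ ?_) hlt.le)
    · have e : n * S.infoMean - n * (R + η) = n * η := by rw [hη]; ring
      rw [e, ← S.sum_pairProb_mul_neg_centeredDensity_sq]
      exact upperTail_le_variance_div S.pairProb_nonneg S.sum_pairProb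
        S.sum_pairProb_mul_neg_centeredDensity n (by positivity)
    · calc _ ≤ 2 * Real.exp (n * R) * Real.exp (-(n * (R + η))) := by
            gcongr
            exact (natCeil_exp _).2.2 (by positivity)
        _ = _ := by
            rw [mul_assoc, ← Real.exp_add]
            congr 2
            ring

lemma le_infoMean_of_isAchievable {R : ℝ} (h : S.IsAchievable (1 / 2) R) : R ≤ S.infoMean := by
  by_contra! hlt
  obtain ⟨M, g, hM, hlim, herr⟩ := h
  -- With R = I + 4η, eventually log M > n(I + 2η). The threshold n(I + η) then leaves a gap η on
  -- both sides, and Pc falls below the value 1/4 that the error bound forces it to exceed.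
  set η := (R - S.infoMean) / 4 with hη
  have hη0 : 0 < η := by rw [hη]; linarith
  have h1 : ∀ᶠ n in atTop, ((S.infoMean + 2 * η : ℝ) : EReal)
      < ((Real.log (M n : ℝ) / (n : ℝ) : ℝ) : EReal) :=
    eventually_lt_of_lt_liminf (lt_of_lt_of_le (EReal.coe_lt_coe_iff.2 (by linarith)) hlim)
  have h2 : ∀ᶠ n in atTop, ((S.probError (g n) : ℝ) : EReal) < ((3 / 4 : ℝ) : EReal) :=
    eventually_lt_of_limsup_lt (lt_of_le_of_lt herr (EReal.coe_lt_coe_iff.2 (by norm_num)))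
  have h3 := (tendsto_chebyshev_add_exp S.infoVariance hη0).eventually_lt_const
    (show (0 : ℝ) < 1 / 4 by norm_num)
  obtain ⟨n, hn1, hn2, hn3, hn0⟩ := (h1.and (h2.and (h3.and (eventually_gt_atTop 0)))).exists
  have hn' : (0 : ℝ) < n := by exact_mod_cast hn0
  have hM0 : (0 : ℝ) < M n := by exact_mod_cast hM n
  rw [EReal.coe_lt_coe_iff] at hn1 hn2
  rw [lt_div_iff₀ hn'] at hn1
  have hc := S.probCorrect_le (hM n) (g n) (n * (S.infoMean + η))
  have ht : S.densityTail n (n * (S.infoMean + η)) ≤ n * S.infoVariance / (n * η) ^ 2 := by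
    refine (S.densityTail_le_upperTail n _).trans ?_
    have e : n * (S.infoMean + η) - n * S.infoMean = n * η := by ring
    rw [e, ← S.sum_pairProb_mul_centeredDensity_sq]
    exact upperTail_le_variance_div S.pairProb_nonneg S.sum_pairProb
      S.sum_pairProb_mul_centeredDensity n (by positivity)
  have he : Real.exp (n * (S.infoMean + η)) / M n ≤ Real.exp (-(n * η)) := by
    rw [div_le_iff₀ hM0]
    calc _ = Real.exp (-(n * η)) * Real.exp ((S.infoMean + 2 * η) * n) := by
          rw [← Real.exp_add]
          congr 1
          ring
      _ ≤ _ := by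
          gcongr
          exact (Real.le_log_iff_exp_le hM0).1 hn1.le
  have := Real.exp_pos (-(n * η))
  linarith [S.probCorrect_add_probError (hM n) (g n)]

lemma capacity_eq_infoMean (hV : 0 < S.infoVariance) : S.capacity = S.infoMean := by
  have hC := S.infoMean_pos hV
  refine IsGreatest.csSup_eq ⟨?_, ?_⟩
  · refine Set.mem_iInter₂.2 fun ε hε => ?_
    have hsub : Set.Ioo 0 S.infoMean ⊆ {R : ℝ | S.IsAchievable ε R} := fun R hR =>
      S.isAchievable_of_lt hε.1 hR.1.le hR.2
    refine closure_mono hsub ?_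
    rw [closure_Ioo hC.ne]
    exact ⟨hC.le, le_rfl⟩
  · intro R hR
    have h := Set.mem_iInter₂.1 hR (1 / 2) ⟨by norm_num, by norm_num⟩
    have hsub : {R : ℝ | S.IsAchievable (1 / 2) R} ⊆ Set.Iic S.infoMean := fun R h =>
      S.le_infoMean_of_isAchievable h
    exact closure_minimal hsub isClosed_Iic h

end BioModel

/-! ### From exponential bounds to the limit of the exponent -/

namespace FiniteIID

lemma tendsto_neg_log_div {f b : ℕ → ℝ} {L : ℝ} (hb : ∀ᶠ n in atTop, 0 < b n)
    (hle : ∀ c < L, ∀ᶠ n in atTop, f n ≤ Real.exp (-(b n * c)))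
    (hge : ∀ c > L, ∀ᶠ n in atTop, Real.exp (-(b n * c)) ≤ f n) :
    Tendsto (fun n => -Real.log (f n) / b n) atTop (𝓝 L) := by
  refine tendsto_order.2 ⟨fun c hc => ?_, fun c hc => ?_⟩
  · obtain ⟨c', hc', hc'L⟩ := exists_between hc
    -- The lower bound at L + 1 serves only to make f positive, so that its logarithm is meaningful.
    filter_upwards [hb, hle c' hc'L, hge (L + 1) (by linarith)] with n hbn h1 h2
    have hf : 0 < f n := (Real.exp_pos _).trans_le h2
    have := (Real.log_le_iff_le_exp hf).2 h1
    rw [lt_div_iff₀ hbn]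
    nlinarith
  · obtain ⟨c', hc'L, hc'⟩ := exists_between hc
    filter_upwards [hb, hge c' hc'L] with n hbn h2
    have hf : 0 < f n := (Real.exp_pos _).trans_le h2
    have := (Real.le_log_iff_exp_le hf).2 h2
    rw [div_lt_iff₀ hbn]
    nlinarith

lemma eventually_three_mul_exp_le {b : ℕ → ℝ} (hb : Tendsto b atTop atTop) {c c' : ℝ}
    (h : c < c') : ∀ᶠ n in atTop, 3 * Real.exp (-(b n * c')) ≤ Real.exp (-(b n * c)) := by
  filter_upwards [hb.eventually_ge_atTop (Real.log 3 / (c' - c))] with n hn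
  rw [div_le_iff₀ (sub_pos.2 h)] at hn
  rw [← Real.exp_log (show (0 : ℝ) < 3 by norm_num), ← Real.exp_add]
  exact Real.exp_le_exp.2 (by linarith)

/-- A gap dξ between rate and threshold costs exp(-ndξ), which beats every exp(-cnξ²) because ξ → 0.
-/
lemma eventually_exp_linear_le {ξ : ℕ → ℝ} (hξpos : ∀ᶠ n in atTop, 0 < ξ n)
    (hξ0 : Tendsto ξ atTop (𝓝 0)) {d : ℝ} (hd : 0 < d) (c : ℝ) :
    ∀ᶠ n : ℕ in atTop, Real.exp (-(n * (d * ξ n))) ≤ Real.exp (-(n * ξ n ^ 2 * c)) := by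
  filter_upwards [hξpos, eventually_mul_lt hξ0 c hd] with n hx h
  refine Real.exp_le_exp.2 (neg_le_neg ?_)
  have : c * ξ n * (n * ξ n) ≤ d * (n * ξ n) := mul_le_mul_of_nonneg_right h.le (by positivity)
  linarith

lemma exists_lt_one_of_lt {V c : ℝ} (hc : c < 1 / (2 * V)) :
    ∃ a c' : ℝ, 0 < a ∧ a < 1 ∧ c < c' ∧ c' < a ^ 2 / (2 * V) := by
  have hcont : Continuous fun a : ℝ => a ^ 2 / (2 * V) := by fun_prop
  have h := (hcont.tendsto 1).mono_left (nhdsWithin_le_nhds (s := Set.Iio 1))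
  rw [one_pow] at h
  obtain ⟨a, ⟨h1, h2⟩, h3⟩ := (((h.eventually_const_lt hc).and
    (nhdsWithin_le_nhds (lt_mem_nhds one_pos))).and self_mem_nhdsWithin).exists
  obtain ⟨c', h4, h5⟩ := exists_between h1
  exact ⟨a, c', h2, h3, h4, h5⟩

lemma exists_one_lt_of_lt {V c : ℝ} (hc : 1 / (2 * V) < c) :
    ∃ a c' : ℝ, 1 < a ∧ a ^ 2 / (2 * V) < c' ∧ c' < c := by
  have hcont : Continuous fun a : ℝ => a ^ 2 / (2 * V) := by fun_prop
  have h := (hcont.tendsto 1).mono_left (nhdsWithin_le_nhds (s := Set.Ioi 1))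
  rw [one_pow] at h
  obtain ⟨a, h1, h3⟩ := ((h.eventually_lt_const hc).and self_mem_nhdsWithin).exists
  obtain ⟨c', h4, h5⟩ := exists_between h1
  exact ⟨a, c', h3, h4, h5⟩

end FiniteIID

/-! ### The four bounds at rates I ± ξ -/

namespace BioModel

open FiniteIID

variable {X Y Z : Type*} [Fintype X] [Fintype Y] [Fintype Z] (S : BioModel X Y Z)
  {ξ : ℕ → ℝ} {c : ℝ}

lemma eventually_maxProbCorrect_le (hV : 0 < S.infoVariance)
    (hξpos : ∀ᶠ n in atTop, 0 < ξ n) (hξ0 : Tendsto ξ atTop (𝓝 0))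
    (hξ : Tendsto (fun n : ℕ => Real.sqrt (n : ℝ) * ξ n) atTop atTop)
    (hc : c < 1 / (2 * S.infoVariance)) :
    ∀ᶠ n : ℕ in atTop,
      S.maxProbCorrect n (S.infoMean + ξ n) ≤ Real.exp (-(n * ξ n ^ 2 * c)) := by
  obtain ⟨a, c', ha0, ha1, hcc', hc'⟩ := exists_lt_one_of_lt hc
  filter_upwards [eventually_upperTail_le S.pairProb_nonneg S.sum_pairProb
      S.sum_pairProb_mul_centeredDensity S.sum_pairProb_mul_centeredDensity_sq hV hξpos hξ0 ha0 hc',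
    eventually_exp_linear_le hξpos hξ0 (sub_pos.2 ha1) c',
    eventually_three_mul_exp_le (tendsto_mul_sq_atTop hξ) hcc'] with n h1 h2 h3
  have h4 := S.maxProbCorrect_le n (S.infoMean + ξ n) (n * (S.infoMean + a * ξ n))
  have h5 := S.densityTail_le_upperTail n (n * (S.infoMean + a * ξ n))
  have e1 : n * (S.infoMean + a * ξ n) - n * S.infoMean = n * (a * ξ n) := by ring
  have e2 : n * (S.infoMean + a * ξ n) - n * (S.infoMean + ξ n) = -(n * ((1 - a) * ξ n)) := by
    ring
  rw [e1] at h5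
  rw [e2] at h4
  linarith [Real.exp_pos (-(n * ξ n ^ 2 * c'))]

lemma eventually_le_maxProbCorrect (hV : 0 < S.infoVariance)
    (hξpos : ∀ᶠ n in atTop, 0 < ξ n) (hξ0 : Tendsto ξ atTop (𝓝 0))
    (hξ : Tendsto (fun n : ℕ => Real.sqrt (n : ℝ) * ξ n) atTop atTop)
    (hc : 1 / (2 * S.infoVariance) < c) :
    ∀ᶠ n : ℕ in atTop,
      Real.exp (-(n * ξ n ^ 2 * c)) ≤ S.maxProbCorrect n (S.infoMean + ξ n) := by
  obtain ⟨a, c', ha1, hc', hcc'⟩ := exists_one_lt_of_lt hc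
  have hC := S.infoMean_pos hV
  have hb := tendsto_mul_sq_atTop hξ
  filter_upwards [eventually_le_upperTail S.pairProb_nonneg S.sum_pairProb
      S.sum_pairProb_mul_centeredDensity S.sum_pairProb_mul_centeredDensity_sq hV hξpos hξ0 hξ
      (one_pos.trans ha1) hc',
    eventually_three_mul_exp_le hb hcc', hξpos, hξ0.eventually_lt_const one_pos,
    hb.eventually_gt_atTop (Real.log 4 / (a - 1))] with n h1 h2 hx hx1 hlog
  set R := S.infoMean + ξ n with hR
  have hR0 : 0 ≤ n * R := by rw [hR]; positivity
  obtain ⟨hM, hMR, hM2⟩ := natCeil_exp (n * R)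
  -- The shift log 4 makes M·exp(-t) at most 2/4, so half the tail survives. The shift itself fits
  -- into (a-1)nξ, since nξ ≥ nξ² → ∞.
  obtain ⟨g, hg⟩ := S.exists_le_probCorrect n hM (n * R + Real.log 4)
  have hmax := S.probCorrect_le_maxProbCorrect hM hMR g
  have hhalf : (⌈Real.exp (n * R)⌉₊ : ℝ) * Real.exp (-(n * R + Real.log 4)) ≤ 1 / 2 := by
    calc _ ≤ 2 * Real.exp (n * R) * Real.exp (-(n * R + Real.log 4)) := by
          gcongr
          exact hM2 hR0
      _ = 1 / 2 := by
          rw [neg_add, Real.exp_add, Real.exp_neg (Real.log 4), Real.exp_log (by norm_num),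
            Real.exp_neg]
          field_simp
          norm_num
  have hlt : n * R + Real.log 4 < n * (S.infoMean + a * ξ n) := by
    rw [div_lt_iff₀ (sub_pos.2 ha1)] at hlog
    have h3 : n * ξ n ^ 2 ≤ n * ξ n := by
      refine mul_le_mul_of_nonneg_left ?_ (Nat.cast_nonneg n)
      nlinarith
    have h4 := mul_le_mul_of_nonneg_right h3 (sub_pos.2 ha1).le
    rw [hR]
    linarith
  have htail := S.upperTail_le_densityTail n hlt
  have e1 : n * (S.infoMean + a * ξ n) - n * S.infoMean = n * (a * ξ n) := by ring
  rw [e1] at htail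
  have hd := S.densityTail_nonneg n (n * R + Real.log 4)
  nlinarith [Real.exp_pos (-(n * ξ n ^ 2 * c'))]

lemma eventually_one_sub_maxProbCorrect_le (hV : 0 < S.infoVariance)
    (hξpos : ∀ᶠ n in atTop, 0 < ξ n) (hξ0 : Tendsto ξ atTop (𝓝 0))
    (hξ : Tendsto (fun n : ℕ => Real.sqrt (n : ℝ) * ξ n) atTop atTop)
    (hc : c < 1 / (2 * S.infoVariance)) :
    ∀ᶠ n : ℕ in atTop,
      1 - S.maxProbCorrect n (S.infoMean - ξ n) ≤ Real.exp (-(n * ξ n ^ 2 * c)) := by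
  obtain ⟨a, c', ha0, ha1, hcc', hc'⟩ := exists_lt_one_of_lt hc
  filter_upwards [eventually_upperTail_le S.pairProb_nonneg S.sum_pairProb
      S.sum_pairProb_mul_neg_centeredDensity S.sum_pairProb_mul_neg_centeredDensity_sq hV
      hξpos hξ0 ha0 hc',
    eventually_exp_linear_le hξpos hξ0 (sub_pos.2 ha1) c',
    eventually_three_mul_exp_le (tendsto_mul_sq_atTop hξ) hcc',
    hξ0.eventually_lt_const (S.infoMean_pos hV)] with n h1 h2 h3 hx
  set R := S.infoMean - ξ n with hR
  have hR0 : 0 ≤ n * R := mul_nonneg (Nat.cast_nonneg n) (by linarith)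
  obtain ⟨hM, hMR, hM2⟩ := natCeil_exp (n * R)
  -- The threshold lies above the rate because a < 1. One tail plus twice the linear exponential,
  -- the 2 coming from rounding M, is the source of the factor 3.
  obtain ⟨g, hg⟩ := S.exists_probError_le n hM (n * (S.infoMean - a * ξ n))
  have hmax := S.probCorrect_le_maxProbCorrect hM hMR g
  have e1 : n * S.infoMean - n * (S.infoMean - a * ξ n) = n * (a * ξ n) := by ring
  rw [e1] at hg
  have hexp : (⌈Real.exp (n * R)⌉₊ : ℝ) * Real.exp (-(n * (S.infoMean - a * ξ n)))
      ≤ 2 * Real.exp (-(n * ((1 - a) * ξ n))) := by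
    calc _ ≤ 2 * Real.exp (n * R) * Real.exp (-(n * (S.infoMean - a * ξ n))) := by
          gcongr
          exact hM2 hR0
      _ = _ := by
          rw [mul_assoc, ← Real.exp_add, hR]
          congr 2
          ring
  linarith [S.probCorrect_add_probError hM g]

lemma eventually_le_one_sub_maxProbCorrect (hV : 0 < S.infoVariance)
    (hξpos : ∀ᶠ n in atTop, 0 < ξ n) (hξ0 : Tendsto ξ atTop (𝓝 0))
    (hξ : Tendsto (fun n : ℕ => Real.sqrt (n : ℝ) * ξ n) atTop atTop)
    (hc : 1 / (2 * S.infoVariance) < c) :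
    ∀ᶠ n : ℕ in atTop,
      Real.exp (-(n * ξ n ^ 2 * c)) ≤ 1 - S.maxProbCorrect n (S.infoMean - ξ n) := by
  obtain ⟨a, c', ha1, hc', hcc'⟩ := exists_one_lt_of_lt hc
  filter_upwards [eventually_le_upperTail S.pairProb_nonneg S.sum_pairProb
      S.sum_pairProb_mul_neg_centeredDensity S.sum_pairProb_mul_neg_centeredDensity_sq hV
      hξpos hξ0 hξ (one_pos.trans ha1) hc',
    eventually_exp_linear_le hξpos hξ0 (sub_pos.2 ha1) c,
    eventually_three_mul_exp_le (tendsto_mul_sq_atTop hξ) hcc'] with n h1 h2 h3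
  -- Now a > 1 puts the threshold below the rate: the error is at least the lower tail minus
  -- exp(-n(a-1)ξ), and the tail is at least three times the target bound.
  have h4 := S.maxProbCorrect_le n (S.infoMean - ξ n) (n * (S.infoMean - a * ξ n))
  have h5 := S.one_sub_densityTail n (n * (S.infoMean - a * ξ n))
  have e1 : n * S.infoMean - n * (S.infoMean - a * ξ n) = n * (a * ξ n) := by ring
  have e2 : n * (S.infoMean - a * ξ n) - n * (S.infoMean - ξ n) = -(n * ((a - 1) * ξ n)) := by
    ring
  rw [e1] at h5
  rw [e2] at h4
  linarith [Real.exp_pos (-(n * ξ n ^ 2 * c))]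

end BioModel

theorem mainTheorem6 {X Y Z : Type*} [Fintype X] [Fintype Y] [Fintype Z]
    (S : BioModel X Y Z) (hV : 0 < S.infoVariance)
    (ξ : ℕ → ℝ) (hξpos : ∀ n, 1 ≤ n → 0 < ξ n) (hξ0 : Tendsto ξ atTop (𝓝 0))
    (hξ : Tendsto (fun n : ℕ => Real.sqrt (n : ℝ) * ξ n) atTop atTop) :
    Tendsto (fun n : ℕ =>
        -Real.log (S.maxProbCorrect n (S.capacity + ξ n)) / ((n : ℝ) * ξ n ^ 2))
      atTop (𝓝 (1 / (2 * S.infoVariance))) ∧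
    Tendsto (fun n : ℕ =>
        -Real.log (1 - S.maxProbCorrect n (S.capacity - ξ n)) / ((n : ℝ) * ξ n ^ 2))
      atTop (𝓝 (1 / (2 * S.infoVariance))) := by
  rw [S.capacity_eq_infoMean hV]
  have hpos : ∀ᶠ n in atTop, 0 < ξ n := eventually_atTop.2 ⟨1, hξpos⟩
  have hb := (FiniteIID.tendsto_mul_sq_atTop hξ).eventually_gt_atTop 0
  exact ⟨FiniteIID.tendsto_neg_log_div hb
      (fun c hc => S.eventually_maxProbCorrect_le hV hpos hξ0 hξ hc)
      (fun c hc => S.eventually_le_maxProbCorrect hV hpos hξ0 hξ hc),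
    FiniteIID.tendsto_neg_log_div hb
      (fun c hc => S.eventually_one_sub_maxProbCorrect_le hV hpos hξ0 hξ hc)
      (fun c hc => S.eventually_le_one_sub_maxProbCorrect hV hpos hξ0 hξ hc)⟩
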